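/- Let $G=(V,E)$ be a finite graph. An incompatibility system $\mathcal F$ over $G$ is a family $\mathcal F=\{F_v\}_{v\in V}$ where, for every $v\in V$, $F_v$ is a set of unordered pairs $F_v\subseteq\{\{e,e'\} : e\neq e'\in E,\ e\cap e'=\{v\}\}$. Two edges $e,e'$ are incompatible in $\mathcal F$ if $\{e,e'\}\in F_v$ for some $v\in V$, and compatible otherwise; a subgraph of $G$ is compatible with $\mathcal F$ if all its pairs of edges are compatible. For a real number $\Delta$, the system $\mathcal F$ is $\Delta$-bounded if for each vertex $v$ and each edge $e$ incident to $v$ there are at most $\Delta$ other edges $e'$ incident to $v$ that are incompatible with $e$. Let $G(n,p)$ be the random graph on $n$ vertices in which each pair of vertices forms an edge independently with probability $p$. Theorem. There is an absolute constant $\mu>0$ such that for every sequence $p=p(n)\in[0,1]$ with $p\gg\frac{\log n}{n}$ (that is, $\frac{\log n}{n}=o(p(n))$ as $n\to\infty$), the probability that $G=G(n,p)$ has the following property tends to $1$ as $n\to\infty$: for every $\mu np$-bounded incompatibility system $\mathcal F$ over $G$ there is a Hamilton cycle in $G$ compatible with $\mathcal F$. -/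

import Mathlib

/-- An incompatibility system over a graph `G`: for every vertex `v` a set `pairs v` of unordered
pairs `{e, e'}` of distinct edges of `G` with `e ∩ e' = {v}`. -/
structure IncompatibilitySystem {V : Type*} (G : SimpleGraph V) where
  /-- The set of unordered pairs of edges attached to the vertex `v`. -/
  pairs : V → Set (Sym2 (Sym2 V))
  /-- Each such pair consists of two distinct edges of `G` whose only common vertex is `v`. -/
  pairs_spec : ∀ (v : V) (e e' : Sym2 V), s(e, e') ∈ pairs v →
    e ≠ e' ∧ e ∈ G.edgeSet ∧ e' ∈ G.edgeSet ∧ ∀ w : V, (w ∈ e ∧ w ∈ e') ↔ w = v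

namespace IncompatibilitySystem

/-- Two edges are incompatible if the pair they form belongs to the system at some vertex. -/
def Incompatible {V : Type*} {G : SimpleGraph V} (F : IncompatibilitySystem G)
    (e e' : Sym2 V) : Prop :=
  ∃ v : V, s(e, e') ∈ F.pairs v

/-- A subgraph is compatible with the system if no two of its edges are incompatible. -/
def IsCompatible {V : Type*} {G : SimpleGraph V} (F : IncompatibilitySystem G)
    (H : G.Subgraph) : Prop :=
  ∀ e ∈ H.edgeSet, ∀ e' ∈ H.edgeSet, ¬ F.Incompatible e e'

/-- The system is `Δ`-bounded if for each vertex `v` and each edge `e` incident to `v` there are at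
most `Δ` other edges incident to `v` that are incompatible with `e`. -/
def IsBounded {V : Type*} [Finite V] {G : SimpleGraph V} (F : IncompatibilitySystem G)
    (Δ : ℝ) : Prop :=
  ∀ (v : V) (e : Sym2 V), e ∈ G.edgeSet → v ∈ e →
    (({e' : Sym2 V | e' ∈ G.edgeSet ∧ v ∈ e' ∧ e' ≠ e ∧ F.Incompatible e e'}.ncard : ℕ) : ℝ) ≤ Δ

/-- The graph `G` has a Hamilton cycle that is compatible with the system. -/
def HasCompatibleHamiltonCycle {V : Type*} [DecidableEq V] {G : SimpleGraph V}
    (F : IncompatibilitySystem G) : Prop :=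
  ∃ (a : V) (c : G.Walk a a), c.IsHamiltonianCycle ∧ F.IsCompatible c.toSubgraph

end IncompatibilitySystem

/-! Write d = np and Δ = μd. Inside G one finds a compatible expander Γ with O(n) edges, then adds
compatible edges of G one at a time, each bringing Γ closer to a Hamilton cycle. Sparseness of Γ is
essential: at most 2Δ|E(Γ)| pairs are incompatible with an edge of Γ, a tiny multiple of dn when μ
is tiny.

Closing up: by Pósa rotations, an expander without a Hamilton cycle has a quadratic number of
boosters, pairs whose addition lengthens a longest path or closes it into a cycle
(`sq_le_two_mul_card_boosters`). The boosters depend on Γ alone. Hence Chernoff and a union bound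
over all graphs with at most 57n edges show that, with high probability, every such graph with many
boosters has order dn of them in G (`prob_not_boosterRich_le`); the entropy n log n of the union
bound is beaten because d is a large multiple of log n. Some booster in G is therefore compatible
with Γ (`exists_compatible_booster`), and the bounded, strictly increasing `progress` stops the
process after O(n) additions.

The expander: every vertex picks 54 edges, one at a time, among those compatible with all earlier
picks. Were the choices random, few picks would spoil the edges at any given vertex, so at least d/8
choices would always remain, and all picks from S would rarely fall into a given T with |T| = 3|S|.
Since the system depends on G, the choices are made deterministically by conditional expectations
(`exists_choice`, `exists_valid`), using only degrees of order d and local sparsity of G.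
`trap_weight_le` and `sum_trap_weight_le` control all the pairs (S, T) at once, and
`exists_compatible_expander` extracts Γ. -/

namespace PathList

/-! ### Path rotations and the local step of Pósa's lemma -/

variable {V : Type*}

/-- A list of vertices that traverses a path of `G`. -/
def IsPathList (G : SimpleGraph V) (l : List V) : Prop :=
  l.Nodup ∧ l.IsChain G.Adj

/-- `y` comes immediately after `x` in the list `l`. -/
def Next (l : List V) (x y : V) : Prop :=
  ∃ A B, l = A ++ x :: y :: B

/-- The lists obtained from `P` by a sequence of rotations at the head. -/
inductive RotReach (G : SimpleGraph V) (P : List V) : List V → Prop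
  | refl : RotReach G P P
  | rot {A B : List V} {x z y : V} : RotReach G P (A ++ z :: y :: B) →
      (A ++ [z]).head? = some x → G.Adj x y → RotReach G P (z :: A.reverse ++ y :: B)

theorem Next.left_unique {l : List V} (hl : l.Nodup) {x x' y : V}
    (h : Next l x y) (h' : Next l x' y) : x = x' := by
  obtain ⟨A, B, rfl⟩ := h
  obtain ⟨A', B', h⟩ := h'
  induction A generalizing A' with
  | nil =>
    cases A' with
    | nil => simp_all
    | cons a A' =>
      simp only [List.nil_append, List.cons_append, List.cons.injEq] at h
      obtain ⟨rfl, h⟩ := h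
      cases A' with
      | nil => simp_all
      | cons b A' => simp_all
  | cons a A ih =>
    cases A' with
    | nil =>
      exfalso
      cases A <;> grind
    | cons b A' =>
      simp only [List.cons_append, List.cons.injEq] at h
      exact ih (by simp_all) A' h.2

theorem Next.right_unique {l : List V} (hl : l.Nodup) {x y y' : V}
    (h : Next l x y) (h' : Next l x y') : y = y' := by
  obtain ⟨A, B, rfl⟩ := h
  obtain ⟨A', B', h⟩ := h'
  induction A generalizing A' with
  | nil =>
    cases A' with
    | nil => simp_all
    | cons a A' => simp_all
  | cons a A ih =>
    cases A' with
    | nil => exfalso; grind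
    | cons b A' =>
      simp only [List.cons_append, List.cons.injEq] at h
      exact ih (by simp_all) A' h.2

namespace RotReach

variable {G : SimpleGraph V} {P Q : List V}

theorem perm (h : RotReach G P Q) : Q.Perm P := by
  induction h with
  | refl => rfl
  | @rot A B x z y h hx hxy ih =>
    refine List.Perm.trans ?_ ih
    have : (z :: A.reverse).Perm (A ++ [z]) := by
      simpa using (List.reverse_perm (A ++ [z]))
    simpa using this.append_right (y :: B)

theorem isPathList (h : RotReach G P Q) (hP : IsPathList G P) : IsPathList G Q := by
  refine ⟨h.perm.nodup_iff.2 hP.1, ?_⟩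
  induction h with
  | refl => exact hP.2
  | @rot A B x z y h hx hxy ih =>
    have e : A ++ z :: y :: B = (A ++ [z]) ++ (y :: B) := by simp
    rw [e, List.isChain_append] at ih
    have e' : z :: A.reverse ++ y :: B = (A ++ [z]).reverse ++ (y :: B) := by simp
    rw [e', List.isChain_append]
    refine ⟨?_, ih.2.1, ?_⟩
    · rw [List.isChain_reverse]
      exact ih.1.imp fun a b hab => hab.symm
    · intro a ha b hb
      rw [List.getLast?_reverse, hx] at ha
      simp only [Option.mem_def, Option.some.injEq, List.head?_cons] at ha hb
      subst ha hb
      exact hxy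

theorem getLast? (h : RotReach G P Q) : Q.getLast? = P.getLast? := by
  induction h with
  | refl => rfl
  | @rot A B x z y h hx hxy ih =>
    rw [← ih]
    simp [List.getLast?_append, List.getLast?_cons]

/-- A rotation breaks only the path edge zy, and z becomes the new head. So an edge of the original
path survives, up to direction, until one of its endpoints has been an end. -/
theorem next_or_mem_ends (h : RotReach G P Q) {u v : V} (huv : Next P u v) :
    (Next Q u v ∨ Next Q v u) ∨ (∃ B, RotReach G P (u :: B)) ∨ ∃ B, RotReach G P (v :: B) := by
  induction h with
  | refl => exact Or.inl (Or.inl huv)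
  | @rot A B x z y h hx hxy ih =>
    have hnew := RotReach.rot h hx hxy
    have key : ∀ a b, Next (A ++ z :: y :: B) a b →
        Next (z :: A.reverse ++ y :: B) a b ∨ Next (z :: A.reverse ++ y :: B) b a ∨ a = z := by
      rintro a b ⟨A', B', e⟩
      rw [List.append_eq_append_iff] at e
      rcases e with ⟨C, rfl, e⟩ | ⟨C, rfl, e⟩
      · cases C with
        | nil => simp_all
        | cons c C =>
          simp only [List.cons_append, List.cons.injEq] at e
          obtain ⟨rfl, e⟩ := e
          left
          refine ⟨z :: A.reverse ++ C, B', ?_⟩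
          simp [e]
      · cases C with
        | nil => simp_all
        | cons c C =>
          simp only [List.cons_append, List.cons.injEq] at e
          obtain ⟨rfl, e⟩ := e
          right; left
          cases C with
          | nil =>
            simp only [List.nil_append, List.cons.injEq] at e
            obtain ⟨rfl, e⟩ := e
            exact ⟨[], A'.reverse ++ y :: B, by simp⟩
          | cons c C =>
            simp only [List.cons_append, List.cons.injEq] at e
            obtain ⟨rfl, e⟩ := e
            exact ⟨z :: C.reverse, A'.reverse ++ y :: B, by simp⟩
    rcases ih with (h1 | h1) | h1
    · rcases key _ _ h1 with h2 | h2 | rfl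
      · exact Or.inl (Or.inl h2)
      · exact Or.inl (Or.inr h2)
      · exact Or.inr (Or.inl ⟨_, hnew⟩)
    · rcases key _ _ h1 with h2 | h2 | rfl
      · exact Or.inl (Or.inr h2)
      · exact Or.inl (Or.inl h2)
      · exact Or.inr (Or.inr ⟨_, hnew⟩)
    · exact Or.inr h1

/-- The key step of Pósa's lemma: a neighbour of an end vertex is an end vertex or stands next to one
on the original path. -/
theorem ends_neighbor (hP : IsPathList G P) {x y : V} {B : List V}
    (h : RotReach G P (x :: B)) (hxy : G.Adj x y) (hy : y ∈ P)
    (hyS : ¬ ∃ C, RotReach G P (y :: C)) :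
    ∃ s, (∃ C, RotReach G P (s :: C)) ∧ (Next P s y ∨ Next P y s) := by
  have hyQ : y ∈ x :: B := h.perm.mem_iff.2 hy
  have hyB : y ∈ B := by
    rcases List.mem_cons.1 hyQ with rfl | h'
    · exact (hxy.ne rfl).elim
    · exact h'
  obtain ⟨A₀, C, rfl⟩ := List.append_of_mem hyB
  obtain ⟨A, z, hz⟩ : ∃ A z, x :: A₀ = A ++ [z] :=
    ⟨_, _, (List.dropLast_append_getLast (List.cons_ne_nil x A₀)).symm⟩
  have e : x :: (A₀ ++ y :: C) = A ++ z :: y :: C := by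
    rw [← List.cons_append, hz]; simp
  have hx : (A ++ [z]).head? = some x := by rw [← hz]; rfl
  rw [e] at h
  have hQ := (h.isPathList hP).1
  -- The predecessor z of y on the current path becomes an end by rotating along xy. If no neighbour
  -- of y on P is an end, both path edges at y survive, and neither can lead to z: both would have
  -- to lead to the successor of y.
  have hzS : ∃ C, RotReach G P (z :: C) := ⟨_, RotReach.rot h hx hxy⟩
  by_contra hcon
  push Not at hcon
  have hzy : Next (A ++ z :: y :: C) z y := ⟨A, C, rfl⟩
  obtain ⟨L, R, hLR⟩ := List.append_of_mem hy
  have hL : L ≠ [] := by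
    rintro rfl
    exact hyS ⟨R, by rw [List.nil_append] at hLR; rw [← hLR]; exact .refl⟩
  obtain ⟨L', u, rfl⟩ : ∃ L' u, L = L' ++ [u] :=
    ⟨_, _, (List.dropLast_append_getLast hL).symm⟩
  have huy : Next P u y := ⟨L', R, by rw [hLR]; simp⟩
  have huS : ¬ ∃ C, RotReach G P (u :: C) := fun h' => (hcon u h').1 huy
  have hyu : Next (A ++ z :: y :: C) y u := by
    rcases h.next_or_mem_ends huy with (h1 | h1) | h1 | h1
    · have := h1.left_unique hQ hzy
      subst this
      exact (huS hzS).elim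
    · exact h1
    · exact (huS h1).elim
    · exact (hyS h1).elim
  cases R with
  | nil =>
    -- Here y is the last vertex of P. Rotations fix the last vertex, so y cannot be followed by u.
    have hlast := h.getLast?
    rw [hLR] at hlast
    obtain ⟨A', C', e'⟩ := hyu
    rw [e'] at hlast hQ
    have : (u :: C').getLast? = some y := by
      simpa [List.getLast?_append, List.getLast?_cons] using hlast
    have : y ∈ u :: C' := List.mem_of_getLast? this
    simp_all [List.nodup_append]
  | cons w R =>
    have hyw : Next P y w := ⟨L' ++ [u], R, by rw [hLR]⟩
    have hwS : ¬ ∃ C, RotReach G P (w :: C) := fun h' => (hcon w h').2 hyw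
    have hyw' : Next (A ++ z :: y :: C) y w := by
      rcases h.next_or_mem_ends hyw with (h1 | h1) | h1 | h1
      · exact h1
      · have := h1.left_unique hQ hzy
        subst this
        exact (hwS hzS).elim
      · exact (hyS h1).elim
      · exact (hwS h1).elim
    have := hyu.right_unique hQ hyw'
    subst this
    have := hP.1
    rw [hLR] at this
    simp [List.nodup_append] at this

end RotReach

end PathList

/-! ### Expansion, longest paths and boosters -/

namespace PathList

variable {V : Type*}

/-- Every nonempty set of at most `m` vertices has more than twice as many outside neighbours. -/
def Expands (G : SimpleGraph V) (m : ℕ) : Prop :=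
  ∀ S T : Finset V, S.Nonempty → S.card ≤ m → S ⊆ T →
    (∀ x ∈ S, ∀ y, G.Adj x y → y ∈ T) → 3 * S.card < T.card

theorem Expands.mono {G H : SimpleGraph V} {m : ℕ} (hG : Expands G m) (h : G ≤ H) : Expands H m :=
  fun S T hS hm hST hT => hG S T hS hm hST fun x hx y hxy => hT x hx y (h hxy)

theorem IsPathList.mono {G H : SimpleGraph V} {l : List V} (hl : IsPathList G l) (h : G ≤ H) :
    IsPathList H l :=
  ⟨hl.1, hl.2.imp fun _ _ hab => h hab⟩

theorem IsPathList.reverse {G : SimpleGraph V} {l : List V} (hl : IsPathList G l) :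
    IsPathList G l.reverse :=
  ⟨List.nodup_reverse.2 hl.1, List.isChain_reverse.2 (hl.2.imp fun _ _ hab => hab.symm)⟩

/-- The list `l` traverses a cycle of `G`. -/
def IsCycleList (G : SimpleGraph V) (l : List V) : Prop :=
  IsPathList G l ∧ 3 ≤ l.length ∧ ∃ x y, l.head? = some x ∧ l.getLast? = some y ∧ G.Adj y x

theorem IsCycleList.rotate_head {G : SimpleGraph V} {l : List V} (hl : IsCycleList G l)
    {x : V} (hx : x ∈ l) :
    ∃ l', IsPathList G (x :: l') ∧ (x :: l').Perm l := by
  obtain ⟨A, B, rfl⟩ := List.append_of_mem hx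
  refine ⟨B ++ A, ?_, ?_⟩
  · obtain ⟨⟨hnd, hch⟩, -, a, b, ha, hb, hab⟩ := hl
    refine ⟨?_, ?_⟩
    · have : (x :: (B ++ A)).Perm (A ++ x :: B) := by
        rw [← List.cons_append]; exact List.perm_append_comm
      exact this.nodup_iff.2 hnd
    · rw [List.isChain_append] at hch
      rw [← List.cons_append, List.isChain_append]
      refine ⟨hch.2.1, hch.1, ?_⟩
      intro u hu v hv
      cases A with
      | nil => simp at hv
      | cons c A =>
        simp only [List.cons_append, List.head?_cons, Option.some.injEq] at ha
        simp only [List.head?_cons, Option.mem_def, Option.some.injEq] at hv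
        rw [List.getLast?_append_of_ne_nil _ (by simp)] at hb
        rw [Option.mem_def, hb] at hu
        simp only [Option.some.injEq] at hu
        rw [← hu, ← hv, ha]
        exact hab
  · rw [← List.cons_append]; exact List.perm_append_comm

section Fintype

variable [Fintype V]

/-- The number of vertices of a longest path. -/
noncomputable def pathNum (G : SimpleGraph V) : ℕ :=
  sSup {k | ∃ l, IsPathList G l ∧ l.length = k}

theorem bddAbove_pathLengths (G : SimpleGraph V) :
    BddAbove {k | ∃ l, IsPathList G l ∧ l.length = k} := by
  refine ⟨Fintype.card V, ?_⟩
  rintro _ ⟨l, hl, rfl⟩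
  exact hl.1.length_le_card

theorem IsPathList.length_le_pathNum {G : SimpleGraph V} {l : List V} (hl : IsPathList G l) :
    l.length ≤ pathNum G :=
  le_csSup (bddAbove_pathLengths G) ⟨l, hl, rfl⟩

theorem exists_pathNum (G : SimpleGraph V) : ∃ l, IsPathList G l ∧ l.length = pathNum G :=
  Nat.sSup_mem (s := {k | ∃ l, IsPathList G l ∧ l.length = k})
    ⟨0, [], ⟨List.nodup_nil, List.isChain_nil⟩, rfl⟩ (bddAbove_pathLengths G)

theorem pathNum_le_card (G : SimpleGraph V) : pathNum G ≤ Fintype.card V := by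
  obtain ⟨l, hl, h⟩ := exists_pathNum G
  rw [← h]
  exact hl.1.length_le_card

theorem pathNum_mono {G H : SimpleGraph V} (h : G ≤ H) : pathNum G ≤ pathNum H := by
  obtain ⟨l, hl, e⟩ := exists_pathNum G
  rw [← e]
  exact (hl.mono h).length_le_pathNum

open Classical in
/-- A measure of how close `G` is to having a Hamilton cycle. -/
noncomputable def progress (G : SimpleGraph V) : ℕ :=
  2 * pathNum G + if ∃ l, IsCycleList G l ∧ l.length = pathNum G then 1 else 0

theorem progress_le (G : SimpleGraph V) : progress G ≤ 2 * Fintype.card V + 1 := by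
  have := pathNum_le_card G
  unfold progress
  split_ifs <;> omega

open Classical in
/-- The pairs whose addition to `G` increases `progress`. -/
noncomputable def boosters (G : SimpleGraph V) : Finset (Sym2 V) :=
  Finset.univ.filter fun e =>
    ¬ e.IsDiag ∧ progress G < progress (G ⊔ SimpleGraph.fromEdgeSet {e})

open Classical in
/-- The set of vertices that become the head of the path after some rotations. -/
noncomputable def ends (G : SimpleGraph V) (P : List V) : Finset V :=
  Finset.univ.filter fun x => ∃ B, RotReach G P (x :: B)

theorem mem_ends {G : SimpleGraph V} {P : List V} {x : V} :
    x ∈ ends G P ↔ ∃ B, RotReach G P (x :: B) := by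
  simp [ends]

theorem RotReach.adj_mem {G : SimpleGraph V} {P : List V} (hP : IsPathList G P)
    (hlen : P.length = pathNum G) {x y : V} {B : List V} (h : RotReach G P (x :: B))
    (hxy : G.Adj x y) : y ∈ P := by
  by_contra hy
  have hy' : y ∉ x :: B := fun h' => hy (h.perm.mem_iff.1 h')
  have hQ := h.isPathList hP
  have : IsPathList G (y :: x :: B) :=
    ⟨List.nodup_cons.2 ⟨hy', hQ.1⟩, List.isChain_cons_cons.2 ⟨hxy.symm, hQ.2⟩⟩
  have h1 := this.length_le_pathNum
  have h2 := h.perm.length_eq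
  simp only [List.length_cons] at h1 h2
  omega

/-- Pósa's lemma. -/
theorem card_ends_gt {G : SimpleGraph V} {m : ℕ} (hG : Expands G m) {P : List V}
    (hP : IsPathList G P) (hlen : P.length = pathNum G) (hne : P ≠ []) :
    m < (ends G P).card := by
  classical
  by_contra! hle
  set S := ends G P with hS
  -- f and g are the successor and predecessor on P. The default value s keeps the union below
  -- within size 3|S|, and by `ends_neighbor` that union contains all neighbours of S.
  let f : V → V := fun s => if h : ∃ y, Next P s y then h.choose else s
  let g : V → V := fun s => if h : ∃ y, Next P y s then h.choose else s
  have hSne : S.Nonempty := by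
    obtain ⟨x, B, rfl⟩ := List.exists_cons_of_ne_nil hne
    exact ⟨x, mem_ends.2 ⟨B, .refl⟩⟩
  have := hG S (S ∪ S.image f ∪ S.image g) hSne hle
    (by rw [Finset.union_assoc]; exact Finset.subset_union_left) ?_
  · have h1 := Finset.card_union_le (S ∪ S.image f) (S.image g)
    have h2 := Finset.card_union_le S (S.image f)
    have h3 := Finset.card_image_le (s := S) (f := f)
    have h4 := Finset.card_image_le (s := S) (f := g)
    omega
  · intro x hx y hxy
    obtain ⟨B, hB⟩ := mem_ends.1 hx
    by_cases hyS : y ∈ S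
    · simp [hyS]
    obtain ⟨s, hs, h | h⟩ := hB.ends_neighbor hP hxy (hB.adj_mem hP hlen hxy)
      (fun h => hyS (mem_ends.2 h))
    · have hex : ∃ y, Next P s y := ⟨y, h⟩
      have : f s = y := by
        simp only [f, dif_pos hex]
        exact hex.choose_spec.right_unique hP.1 h
      simp only [Finset.mem_union, Finset.mem_image]
      exact Or.inl (Or.inr ⟨s, mem_ends.2 hs, this⟩)
    · have hex : ∃ y, Next P y s := ⟨y, h⟩
      have : g s = y := by
        simp only [g, dif_pos hex]
        exact hex.choose_spec.left_unique hP.1 h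
      simp only [Finset.mem_union, Finset.mem_image]
      exact Or.inr ⟨s, mem_ends.2 hs, this⟩

/-- All neighbours of the head of a longest path lie on the path, so expansion of that single vertex
applies with the vertex set of the path. This excludes degenerate cycles. -/
theorem three_lt_pathNum [Nonempty V] {G : SimpleGraph V} {m : ℕ} (hm : 1 ≤ m)
    (hG : Expands G m) : 3 < pathNum G := by
  classical
  obtain ⟨P, hP, hlen⟩ := exists_pathNum G
  have hne : P ≠ [] := by
    rintro rfl
    obtain ⟨v⟩ := ‹Nonempty V›
    have : IsPathList G [v] := ⟨List.nodup_singleton v, List.isChain_singleton v⟩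
    have := this.length_le_pathNum
    simp only [List.length_nil, List.length_singleton] at *
    omega
  obtain ⟨x, B, rfl⟩ := List.exists_cons_of_ne_nil hne
  have := hG {x} (x :: B).toFinset (by simp) (by simpa using hm) (by simp) (by
    intro z hz y hy
    rw [Finset.mem_singleton] at hz
    subst hz
    exact List.mem_toFinset.2 (RotReach.adj_mem hP hlen .refl hy))
  rw [List.toFinset_card_of_nodup hP.1, hlen] at this
  simpa using this

/-- Opening the cycle at x and prepending y gives a longer path. -/
theorem mem_boosters_of_cycle {G : SimpleGraph V} {l : List V} (hl : IsCycleList G l)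
    (hlen : l.length = pathNum G) {x y : V} (hx : x ∈ l) (hy : y ∉ l) :
    s(x, y) ∈ boosters G := by
  have hne : x ≠ y := by rintro rfl; exact hy hx
  obtain ⟨l', h1, h2⟩ := hl.rotate_head hx
  have hle : G ≤ G ⊔ SimpleGraph.fromEdgeSet {s(x, y)} := le_sup_left
  have h3 : IsPathList (G ⊔ SimpleGraph.fromEdgeSet {s(x, y)}) (y :: x :: l') := by
    refine ⟨List.nodup_cons.2 ⟨fun h => hy (h2.mem_iff.1 h), h1.1⟩,
      List.isChain_cons_cons.2 ⟨?_, (h1.mono hle).2⟩⟩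
    right
    simp [Sym2.eq_swap, hne.symm]
  have h4 := h3.length_le_pathNum
  have h5 := h2.length_eq
  simp only [List.length_cons] at h4 h5
  simp only [boosters, Finset.mem_filter, Finset.mem_univ, true_and, Sym2.mk_isDiag_iff]
  refine ⟨hne, ?_⟩
  -- The longer path gains 2, which outweighs the possible loss of the cycle indicator; hence the
  -- factor 2 in `progress`.
  unfold progress
  split_ifs <;> omega

/-- The new edge closes the path into a cycle. Either this cycle is still of maximal length, turning
on the indicator, or the longest path has grown. -/
theorem mem_boosters_of_path {G : SimpleGraph V} {l : List V} (hl : IsPathList G l)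
    (hlen : l.length = pathNum G) (h3 : 3 ≤ pathNum G)
    (hno : ¬ ∃ l, IsCycleList G l ∧ l.length = pathNum G) {x y : V}
    (hx : l.head? = some x) (hy : l.getLast? = some y) :
    s(x, y) ∈ boosters G := by
  have hne : x ≠ y := by
    rintro rfl
    cases l with
    | nil => simp at hx
    | cons a l =>
      simp only [List.head?_cons, Option.some.injEq] at hx
      subst hx
      cases l with
      | nil => simp only [List.length_cons, List.length_nil] at hlen; omega
      | cons b l =>
        rw [List.getLast?_cons_cons] at hy
        exact (List.nodup_cons.1 hl.1).1 (List.mem_of_getLast? hy)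
  have hle : G ≤ G ⊔ SimpleGraph.fromEdgeSet {s(x, y)} := le_sup_left
  have hcyc : IsCycleList (G ⊔ SimpleGraph.fromEdgeSet {s(x, y)}) l := by
    refine ⟨hl.mono hle, by omega, x, y, hx, hy, ?_⟩
    right
    simp [Sym2.eq_swap, hne.symm]
  have hmono := pathNum_mono hle
  simp only [boosters, Finset.mem_filter, Finset.mem_univ, true_and, Sym2.mk_isDiag_iff]
  refine ⟨hne, ?_⟩
  unfold progress
  rw [if_neg hno]
  rcases hmono.eq_or_lt with h | h
  · rw [if_pos ⟨l, hcyc, by omega⟩]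
    omega
  · omega

/-- By maximality no edge leaves the cycle, so neither its vertex set nor the complement expands.
Both thus exceed m, and every pair between them is a booster. -/
theorem card_boosters_of_cycle {G : SimpleGraph V} {m : ℕ} (hG : Expands G m)
    {l : List V} (hl : IsCycleList G l) (hlen : l.length = pathNum G)
    (hlt : pathNum G < Fintype.card V) : m ^ 2 ≤ (boosters G).card := by
  classical
  set C := l.toFinset with hC
  have hadj : ∀ x ∈ l, ∀ y, G.Adj x y → y ∈ l := by
    intro x hx y hxy
    obtain ⟨l', h1, h2⟩ := hl.rotate_head hx
    have h3 : (x :: l').length = pathNum G := by rw [h2.length_eq, hlen]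
    exact h2.mem_iff.1 (RotReach.adj_mem h1 h3 .refl hxy)
  have hcard : C.card = pathNum G := by
    rw [hC, List.toFinset_card_of_nodup hl.1.1, hlen]
  have h1 : m < C.card := by
    by_contra! h
    have h3 := hl.2.1
    have := hG C C (Finset.card_pos.1 (by omega)) h subset_rfl
      (fun x hx y hxy => List.mem_toFinset.2 (hadj x (List.mem_toFinset.1 hx) y hxy))
    omega
  have hcc : Cᶜ.card = Fintype.card V - C.card := Finset.card_compl C
  have h2 : m < Cᶜ.card := by
    by_contra! h
    have := hG Cᶜ Cᶜ (Finset.card_pos.1 (by omega)) h subset_rfl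
      (fun x hx y hxy => by
        rw [Finset.mem_compl, hC, List.mem_toFinset] at hx ⊢
        exact fun hy => hx (hadj y hy x hxy.symm))
    omega
  calc m ^ 2 ≤ C.card * Cᶜ.card := by rw [sq]; exact Nat.mul_le_mul h1.le h2.le
    _ = (C ×ˢ Cᶜ).card := (Finset.card_product _ _).symm
    _ ≤ (boosters G).card := by
      refine Finset.card_le_card_of_injOn (fun q => s(q.1, q.2)) ?_ ?_
      · rintro ⟨x, y⟩ hq
        simp only [Finset.coe_product, Set.mem_prod, Finset.mem_coe, Finset.mem_compl, hC,
          List.mem_toFinset] at hq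
        exact mem_boosters_of_cycle hl hlen hq.1 hq.2
      · rintro ⟨x, y⟩ hq ⟨x', y'⟩ hq' h
        simp only [Finset.coe_product, Set.mem_prod, Finset.mem_coe, Finset.mem_compl] at hq hq'
        rcases Sym2.eq_iff.1 h with ⟨rfl, rfl⟩ | ⟨rfl, rfl⟩
        · rfl
        · exact (hq'.2 hq.1).elim

/-- Pósa's lemma is applied twice: once for the ends a of a longest path, then, with a fixed as last
vertex by reversal, for the opposite ends t. Each pair at is counted at most twice. -/
theorem card_boosters_of_path [Nonempty V] {G : SimpleGraph V} {m : ℕ} (hm : 1 ≤ m)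
    (hG : Expands G m) (hno : ¬ ∃ l, IsCycleList G l ∧ l.length = pathNum G) :
    m ^ 2 ≤ 2 * (boosters G).card := by
  classical
  have h3 := three_lt_pathNum hm hG
  obtain ⟨P, hP, hlen⟩ := exists_pathNum G
  have hne : P ≠ [] := by rintro rfl; simp at hlen; omega
  have hSm := card_ends_gt hG hP hlen hne
  have key : ∀ a ∈ ends G P, ∃ T : Finset V, m < T.card ∧ ∀ t ∈ T, s(t, a) ∈ boosters G := by
    intro a ha
    obtain ⟨B, hB⟩ := mem_ends.1 ha
    have hR := (hB.isPathList hP).reverse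
    have hRl : (a :: B).reverse.length = pathNum G := by
      rw [List.length_reverse, hB.perm.length_eq, hlen]
    refine ⟨ends G (a :: B).reverse, card_ends_gt hG hR hRl (by simp), ?_⟩
    intro t ht
    obtain ⟨C, hC⟩ := mem_ends.1 ht
    refine mem_boosters_of_path (hC.isPathList hR) (by rw [hC.perm.length_eq, hRl]) (by omega) hno
      (List.head?_cons) ?_
    rw [hC.getLast?]
    simp
  choose! T hT1 hT2 using key
  let D : Finset (V × V) := Finset.univ.filter fun q => q.1 ∈ ends G P ∧ q.2 ∈ T q.1
  have hD : m ^ 2 ≤ D.card := by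
    have : D.card = ∑ a ∈ ends G P, (T a).card := by
      rw [← Finset.card_sigma]
      refine Finset.card_bij' (fun q _ => ⟨q.1, q.2⟩) (fun q _ => (q.1, q.2)) ?_ ?_ ?_ ?_ <;>
        simp [D]
    rw [this, sq]
    calc m * m ≤ (ends G P).card * m := Nat.mul_le_mul_right _ hSm.le
      _ = ∑ a ∈ ends G P, m := by simp
      _ ≤ _ := Finset.sum_le_sum fun a ha => (hT1 a ha).le
  refine hD.trans ((Finset.card_le_mul_card_image (f := fun q : V × V => s(q.2, q.1)) D 2 ?_).trans
    (Nat.mul_le_mul_left 2 (Finset.card_le_card ?_)))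
  · intro e _
    induction e with
    | h x y =>
    refine (Finset.card_le_card (t := {(y, x), (x, y)}) ?_).trans Finset.card_le_two
    rintro ⟨a, b⟩ hq
    simp only [Finset.mem_filter, Sym2.eq_iff] at hq
    simp only [Finset.mem_insert, Finset.mem_singleton, Prod.mk.injEq]
    tauto
  · intro e he
    obtain ⟨⟨a, t⟩, hq, rfl⟩ := Finset.mem_image.1 he
    simp only [D, Finset.mem_filter, Finset.mem_univ, true_and] at hq
    exact hT2 a hq.1 t hq.2

theorem sq_le_two_mul_card_boosters [Nonempty V] {G : SimpleGraph V} {m : ℕ} (hm : 1 ≤ m)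
    (hG : Expands G m) (hno : ¬ ∃ l, IsCycleList G l ∧ l.length = Fintype.card V) :
    m ^ 2 ≤ 2 * (boosters G).card := by
  by_cases h : ∃ l, IsCycleList G l ∧ l.length = pathNum G
  · obtain ⟨l, hl, hlen⟩ := h
    have hlt : pathNum G < Fintype.card V := by
      refine lt_of_le_of_ne (pathNum_le_card G) fun e => hno ⟨l, hl, hlen.trans e⟩
    have := card_boosters_of_cycle hG hl hlen hlt
    omega
  · exact card_boosters_of_path hm hG h

end Fintype

/-- A spanning cyclic list of a subgraph gives a Hamilton cycle with edges in the subgraph. -/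
theorem IsCycleList.exists_isHamiltonianCycle [Fintype V] [DecidableEq V] {G H : SimpleGraph V}
    (hHG : H ≤ G) {l : List V} (hl : IsCycleList H l) (hlen : l.length = Fintype.card V) :
    ∃ (a : V) (c : G.Walk a a), c.IsHamiltonianCycle ∧ c.toSubgraph.edgeSet ⊆ H.edgeSet := by
  obtain ⟨⟨hnd, hch⟩, h3, x, y, hx, hy, hyx⟩ := hl
  have hne : l ≠ [] := by rintro rfl; simp at hx
  let p := SimpleGraph.Walk.ofSupport l hne hch
  have hx' : l.head hne = x := by simpa [List.head?_eq_some_head hne] using hx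
  have hy' : l.getLast hne = y := by simpa [List.getLast?_eq_some_getLast hne] using hy
  have hadj : H.Adj (l.getLast hne) (l.head hne) := by rw [hx', hy']; exact hyx
  have hlp : p.length = l.length - 1 := SimpleGraph.Walk.length_ofSupport hne hch
  have hp : p.IsPath := by
    rw [SimpleGraph.Walk.isPath_def]
    simpa [p, SimpleGraph.Walk.support_ofSupport] using hnd
  have hcyc : (SimpleGraph.Walk.cons hadj p).IsCycle := by
    rw [SimpleGraph.Walk.isCycle_iff_isPath_tail_and_le_length]
    refine ⟨by simpa using hp, ?_⟩
    rw [SimpleGraph.Walk.length_cons]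
    omega
  refine ⟨_, (SimpleGraph.Walk.cons hadj p).mapLe hHG, ?_, ?_⟩
  · rw [SimpleGraph.Walk.isHamiltonianCycle_iff_isCycle_and_length_eq]
    refine ⟨(SimpleGraph.Walk.isCycle_mapLe hHG).2 hcyc, ?_⟩
    rw [SimpleGraph.Walk.length_map, SimpleGraph.Walk.length_cons]
    omega
  · intro e he
    rw [SimpleGraph.Walk.mem_edges_toSubgraph, SimpleGraph.Walk.edges_mapLe_eq_edges] at he
    exact SimpleGraph.Walk.edges_subset_edgeSet _ he

end PathList

/-! ### Conditional expectations and counting of incompatibilities -/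

namespace SparseExpander

/-- Sequential choice by the method of conditional expectations. -/
theorem exists_choice {ι U κ : Type*} [Fintype ι] [DecidableEq ι] [Fintype κ]
    (w : κ → ℝ) (hw : ∀ k, 0 ≤ w k) (f : κ → ι → U → ℝ) (hf : ∀ k i u, 0 ≤ f k i u)
    (g : κ → ι → ℝ) (hg : ∀ k i, 0 ≤ g k i) (P : Finset ι → (ι → U) → Prop)
    (h₀ : ι → U) (hP : P ∅ h₀)
    (step : ∀ D h i, i ∉ D → P D h →
      ∑ k, w k * ((∏ j ∈ D, f k j (h j)) * ∏ j ∈ Dᶜ, g k j) < 1 →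
      ∃ A : Finset U, A.Nonempty ∧ (∀ k, ∑ u ∈ A, f k i u ≤ A.card * g k i) ∧
        ∀ u ∈ A, P (insert i D) (Function.update h i u))
    (start : ∑ k, w k * ∏ j, g k j < 1) :
    ∃ h, P Finset.univ h ∧ ∑ k, w k * ∏ j, f k j (h j) < 1 := by
  -- The invariant: actual factors f for the steps done, a priori bounds g for the steps to come,
  -- and total below 1.
  suffices H : ∀ D : Finset ι, ∃ h, P D h ∧
      ∑ k, w k * ((∏ j ∈ D, f k j (h j)) * ∏ j ∈ Dᶜ, g k j) < 1 by
    obtain ⟨h, h1, h2⟩ := H Finset.univ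
    exact ⟨h, h1, by simpa using h2⟩
  intro D
  induction D using Finset.induction_on with
  | empty => exact ⟨h₀, hP, by simpa using start⟩
  | insert i D hi ih =>
    obtain ⟨h, hPD, hlt⟩ := ih
    obtain ⟨A, hA, hsum, hnext⟩ := step D h i hi hPD hlt
    set a : κ → ℝ := fun k => w k * ((∏ j ∈ D, f k j (h j)) * ∏ j ∈ (insert i D)ᶜ, g k j) with ha
    have ha0 : ∀ k, 0 ≤ a k := fun k =>
      mul_nonneg (hw k) (mul_nonneg (Finset.prod_nonneg fun _ _ => hf _ _ _)
        (Finset.prod_nonneg fun _ _ => hg _ _))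
    have hold : ∀ k, w k * ((∏ j ∈ D, f k j (h j)) * ∏ j ∈ Dᶜ, g k j) = a k * g k i := by
      intro k
      have hc : Dᶜ = insert i (insert i D)ᶜ := by
        ext x; simp only [Finset.mem_compl, Finset.mem_insert]; by_cases hx : x = i <;> simp_all
      rw [hc, Finset.prod_insert (by simp), ha]
      ring
    have hnew : ∀ u k, w k * ((∏ j ∈ insert i D, f k j (Function.update h i u j)) *
        ∏ j ∈ (insert i D)ᶜ, g k j) = a k * f k i u := by
      intro u k
      rw [Finset.prod_insert hi, Function.update_self, ha]
      have : ∏ j ∈ D, f k j (Function.update h i u j) = ∏ j ∈ D, f k j (h j) :=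
        Finset.prod_congr rfl fun j hj => by
          rw [Function.update_of_ne (by rintro rfl; exact hi hj)]
      rw [this]
      ring
    simp only [hold] at hlt
    have : ∃ u ∈ A, ∑ k, a k * f k i u ≤ ∑ k, a k * g k i := by
      apply Finset.exists_le_of_sum_le hA
      rw [Finset.sum_comm, Finset.sum_const, nsmul_eq_mul, Finset.mul_sum]
      refine Finset.sum_le_sum fun k _ => ?_
      rw [← Finset.mul_sum]
      calc a k * ∑ u ∈ A, f k i u ≤ a k * (A.card * g k i) :=
            mul_le_mul_of_nonneg_left (hsum k) (ha0 k)
        _ = _ := by ring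
    obtain ⟨u, hu, hle⟩ := this
    refine ⟨Function.update h i u, hnext u hu, ?_⟩
    simp only [hnew]
    exact hle.trans_lt hlt

variable {V : Type*}

open Classical in
/-- The pairs in `B` that are edges of `G`. -/
noncomputable def hits (G : SimpleGraph V) (B : Finset (Sym2 V)) : Finset (Sym2 V) :=
  B.filter (· ∈ G.edgeSet)

theorem mem_hits {G : SimpleGraph V} {B : Finset (Sym2 V)} {e : Sym2 V} :
    e ∈ hits G B ↔ e ∈ B ∧ e ∈ G.edgeSet := by simp [hits]

section

variable {G : SimpleGraph V} (F : IncompatibilitySystem G)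

variable {F} in
theorem incompatible_comm {e e' : Sym2 V} (h : F.Incompatible e e') : F.Incompatible e' e := by
  obtain ⟨v, hv⟩ := h
  exact ⟨v, by rwa [Sym2.eq_swap]⟩

variable {F} in
theorem mem_edgeSet_of_incompatible {e e' : Sym2 V} (h : F.Incompatible e e') :
    e ∈ G.edgeSet := by
  obtain ⟨v, hv⟩ := h
  exact (F.pairs_spec v e e' hv).2.1

theorem not_incompatible_self (e : Sym2 V) : ¬ F.Incompatible e e := by
  rintro ⟨v, hv⟩
  exact (F.pairs_spec v e e hv).1 rfl

variable {F} in
theorem exists_common_of_incompatible {e e' : Sym2 V} (h : F.Incompatible e e') :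
    ∃ v, v ∈ e ∧ v ∈ e' := by
  obtain ⟨v, hv⟩ := h
  exact ⟨v, ((F.pairs_spec v e e' hv).2.2.2 v).2 rfl⟩

/-- Adding the edge `xu` makes one of `wx`, `wu` unusable. -/
def Spoils (w x u : V) : Prop :=
  F.Incompatible s(w, u) s(x, u) ∨ F.Incompatible s(w, x) s(x, u)

/-- The picks made in the steps of `D` form a compatible family of edges of `G`. -/
structure Valid (c : ℕ) {K : Type*} [DecidableEq V] (D : Finset (V × K)) (h : V × K → V) :
    Prop where
  adj : ∀ i ∈ D, G.Adj i.1 (h i)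
  inj : ∀ i ∈ D, ∀ j ∈ D, i.1 = j.1 → h i = h j → i = j
  indeg : ∀ u, (D.filter fun i => h i = u).card ≤ c
  compat : ∀ i ∈ D, ∀ j ∈ D, ¬ F.Incompatible s(i.1, h i) s(j.1, h j)

end

variable [Fintype V]

open Classical in
/-- The neighbours of `v`. -/
noncomputable def nb (G : SimpleGraph V) (v : V) : Finset V :=
  Finset.univ.filter (G.Adj v)

open Classical in
/-- The pairs of distinct elements of `T`. -/
noncomputable def pairsIn (T : Finset V) : Finset (Sym2 V) :=
  Finset.univ.filter fun e => ¬ e.IsDiag ∧ ∀ x ∈ e, x ∈ T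

theorem mem_nb {G : SimpleGraph V} {v u : V} : u ∈ nb G v ↔ G.Adj v u := by simp [nb]

theorem mem_pairsIn {T : Finset V} {x y : V} :
    s(x, y) ∈ pairsIn T ↔ x ≠ y ∧ x ∈ T ∧ y ∈ T := by simp [pairsIn]

theorem card_le_two_mul_card_hits {G : SimpleGraph V} (D : Finset (V × V)) (T : Finset V)
    (hD : ∀ q ∈ D, G.Adj q.1 q.2 ∧ q.1 ∈ T ∧ q.2 ∈ T) :
    D.card ≤ 2 * (hits G (pairsIn T)).card := by
  classical
  refine ((Finset.card_le_mul_card_image (f := fun q : V × V => s(q.1, q.2)) D 2 ?_).trans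
    (Nat.mul_le_mul_left 2 (Finset.card_le_card ?_)))
  · intro e _
    induction e with
    | h x y =>
    refine (Finset.card_le_card (t := {(x, y), (y, x)}) ?_).trans Finset.card_le_two
    rintro ⟨a, b⟩ hq
    simp only [Finset.mem_filter, Sym2.eq_iff] at hq
    simp only [Finset.mem_insert, Finset.mem_singleton, Prod.mk.injEq]
    tauto
  · intro e he
    obtain ⟨⟨a, b⟩, hq, rfl⟩ := Finset.mem_image.1 he
    obtain ⟨h1, h2, h3⟩ := hD _ hq
    exact mem_hits.2 ⟨mem_pairsIn.2 ⟨h1.ne, h2, h3⟩, h1⟩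

section System

variable {G : SimpleGraph V} (F : IncompatibilitySystem G)

open Classical in
/-- The vertices `u` such that `vu` is incompatible with `e`. -/
noncomputable def blockedAt (v : V) (e : Sym2 V) : Finset V :=
  Finset.univ.filter fun u => F.Incompatible s(v, u) e

theorem mem_blockedAt {v u : V} {e : Sym2 V} :
    u ∈ blockedAt F v e ↔ F.Incompatible s(v, u) e := by simp [blockedAt]

variable {F} in
theorem card_blockedAt_le {Δ : ℝ} (hF : F.IsBounded Δ) {v : V} {e : Sym2 V}
    (hv : v ∈ e) (he : e ∈ G.edgeSet) : ((blockedAt F v e).card : ℝ) ≤ Δ := by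
  refine le_trans ?_ (hF v e he hv)
  rw [← Set.ncard_coe_finset]
  refine Nat.cast_le.2 ?_
  refine Set.ncard_le_ncard_of_injOn (t := {e' : Sym2 V | e' ∈ G.edgeSet ∧ v ∈ e' ∧ e' ≠ e ∧
    F.Incompatible e e'}) (fun u => s(v, u)) ?_ ?_ (Set.toFinite _)
  · intro u hu
    have hu' : F.Incompatible s(v, u) e := (mem_blockedAt F).1 hu
    refine ⟨mem_edgeSet_of_incompatible hu', by simp, ?_, incompatible_comm hu'⟩
    rintro rfl
    exact not_incompatible_self F _ hu'
  · intro u _ u' _ h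
    exact Sym2.congr_right.1 h

open Classical in
/-- The neighbours `u` of `x` such that `xu` makes one of `wx`, `wu` unusable. -/
noncomputable def spoilers (w x : V) : Finset V :=
  (nb G x).filter fun u => Spoils F w x u

-- Each spoiling pick is an edge xu incompatible with wu at u or with wx at x. Counting from the
-- deg(w) edges at w, each is incompatible with at most Δ edges at its far end. The bound is on the
-- sum over x, which is what bounds the expected number of spoiling picks.
variable {F} in
theorem sum_card_spoilers_le {Δ : ℝ} (hF : F.IsBounded Δ) (w : V) :
    (∑ x, (spoilers F w x).card : ℝ) ≤ 2 * (nb G w).card * Δ := by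
  classical
  have h1 : ∑ x, (spoilers F w x).card ≤
      ∑ u ∈ nb G w, (blockedAt F u s(w, u)).card + ∑ x ∈ nb G w, (blockedAt F x s(w, x)).card := by
    simp only [← Finset.card_sigma]
    let α : (Σ _ : V, V) → (Σ _ : V, V) := fun q => ⟨q.2, q.1⟩
    have : (Finset.univ.sigma fun x => spoilers F w x) ⊆
        ((nb G w).sigma fun u => blockedAt F u s(w, u)).image α ∪
          ((nb G w).sigma fun x => blockedAt F x s(w, x)) := by
      rintro ⟨x, u⟩ hq
      simp only [Finset.mem_sigma, Finset.mem_univ, true_and, spoilers, Finset.mem_filter] at hq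
      simp only [Finset.mem_union, Finset.mem_image, Finset.mem_sigma, mem_nb, mem_blockedAt, α]
      rcases hq.2 with h | h
      · left
        refine ⟨⟨u, x⟩, ⟨mem_edgeSet_of_incompatible h, ?_⟩, rfl⟩
        rw [Sym2.eq_swap (a := u)]
        exact incompatible_comm h
      · right
        exact ⟨mem_edgeSet_of_incompatible h, incompatible_comm h⟩
    exact (Finset.card_le_card this).trans ((Finset.card_union_le _ _).trans
      (Nat.add_le_add_right Finset.card_image_le _))
  have h2 : ∀ u ∈ nb G w, ((blockedAt F u s(w, u)).card : ℝ) ≤ Δ := fun u hu =>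
    card_blockedAt_le hF (by simp) (mem_nb.1 hu)
  have h3 : (∑ u ∈ nb G w, ((blockedAt F u s(w, u)).card : ℝ)) ≤ (nb G w).card * Δ := by
    rw [← nsmul_eq_mul]
    exact Finset.sum_le_card_nsmul _ _ _ h2
  have h4 : (∑ x, (spoilers F w x).card : ℝ) ≤
      ∑ u ∈ nb G w, ((blockedAt F u s(w, u)).card : ℝ) +
      ∑ x ∈ nb G w, ((blockedAt F x s(w, x)).card : ℝ) := by exact_mod_cast h1
  linarith

end System

end SparseExpander

/-! ### Choices that remain after some picks -/

namespace SparseExpander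

variable {V : Type*} [Fintype V] [DecidableEq V] {G : SimpleGraph V} {F : IncompatibilitySystem G}
  {K : Type*} [DecidableEq K]

open Classical in
/-- The admissible choices at `v` after the picks `h` in the steps of `D`. -/
noncomputable def available (F : IncompatibilitySystem G) (c : ℕ) (D : Finset (V × K))
    (h : V × K → V) (v : V) : Finset V :=
  (nb G v).filter fun u => (∀ i ∈ D, i.1 = v → h i ≠ u) ∧
    (D.filter fun i => h i = u).card < c ∧ ∀ i ∈ D, ¬ F.Incompatible s(v, u) s(i.1, h i)

theorem available_subset {c : ℕ} {D : Finset (V × K)} {h : V × K → V} (v : V) :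
    available F c D h v ⊆ nb G v := by
  classical
  unfold available
  exact Finset.filter_subset _ _

theorem Valid.update {c : ℕ} {D : Finset (V × K)} {h : V × K → V} (hD : Valid F c D h)
    {i : V × K} (hi : i ∉ D) {u : V} (hu : u ∈ available F c D h i.1) :
    Valid F c (insert i D) (Function.update h i u) := by
  simp only [available, Finset.mem_filter, mem_nb] at hu
  obtain ⟨h1, h2, h3, h4⟩ := hu
  have hne : ∀ j ∈ D, Function.update h i u j = h j := fun j hj =>
    Function.update_of_ne (by rintro rfl; exact hi hj) _ _
  refine ⟨?_, ?_, ?_, ?_⟩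
  · intro j hj
    rcases Finset.mem_insert.1 hj with rfl | hj
    · rwa [Function.update_self]
    · rw [hne j hj]; exact hD.adj j hj
  · intro j hj j' hj' e e'
    rcases Finset.mem_insert.1 hj with rfl | hm <;>
      rcases Finset.mem_insert.1 hj' with rfl | hm'
    · rfl
    · rw [Function.update_self, hne j' hm'] at e'
      exact (h2 j' hm' e.symm e'.symm).elim
    · rw [Function.update_self, hne j hm] at e'
      exact (h2 j hm e e').elim
    · rw [hne j hm, hne j' hm'] at e'
      exact hD.inj j hm j' hm' e e'
  · intro x
    rw [Finset.filter_insert]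
    have hf : (D.filter fun j => Function.update h i u j = x) = D.filter fun j => h j = x :=
      Finset.filter_congr fun j hj => by rw [hne j hj]
    rw [hf, Function.update_self]
    split_ifs with hx
    · subst hx
      exact (Finset.card_insert_le _ _).trans h3
    · exact hD.indeg x
  · intro j hj j' hj'
    rcases Finset.mem_insert.1 hj with rfl | hm <;>
      rcases Finset.mem_insert.1 hj' with rfl | hm'
    · exact not_incompatible_self F _
    · rw [Function.update_self, hne j' hm']
      exact h4 j' hm'
    · rw [Function.update_self, hne j hm]
      exact fun h' => h4 j hm (incompatible_comm h')
    · rw [hne j hm, hne j' hm']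
      exact hD.compat j hm j' hm'

-- A neighbour u of v is lost for one of four reasons: v already picked it; it has been picked c
-- times; vu conflicts with a pick touching v, and there are at most |K| + c of these; or vu
-- conflicts with a pick avoiding v. In the last case the conflict sits at u, so the pick contains u
-- and is a spoiling one, and it costs v at most its two endpoints.
open Classical in
theorem card_nb_le_card_available [Fintype K] {c : ℕ} {Δ : ℝ} (hF : F.IsBounded Δ) (hΔ : 0 ≤ Δ)
    {D : Finset (V × K)} {h : V × K → V} (hD : Valid F c D h) (v : V) :
    ((nb G v).card : ℝ) ≤ (available F c D h v).card + Fintype.card K +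
      ((nb G v).filter fun u => c ≤ (D.filter fun i => h i = u).card).card +
      (Fintype.card K + c) * Δ + 2 * (D.filter fun i => Spoils F v i.1 (h i)).card := by
  set E₁ : Finset V := (D.filter fun i => i.1 = v).image h with hE₁
  set E₂ : Finset V := (nb G v).filter fun u => c ≤ (D.filter fun i => h i = u).card with hE₂
  set E₃ : Finset V := (D.filter fun i => i.1 = v ∨ h i = v).biUnion
    fun i => blockedAt F v s(i.1, h i) with hE₃
  set E₄ : Finset V := (D.filter fun i => Spoils F v i.1 (h i)).biUnion
    fun i => {i.1, h i} with hE₄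
  have hout : (D.filter fun i => i.1 = v).card ≤ Fintype.card K := by
    refine Finset.card_le_card_of_injOn (t := Finset.univ) (fun i => i.2) (by simp) ?_
    intro i hi j hj e
    simp only [Finset.coe_filter, Set.mem_ofPred_eq] at hi hj
    exact Prod.ext (hi.2.trans hj.2.symm) e
  have h1 : E₁.card ≤ Fintype.card K := Finset.card_image_le.trans hout
  have h3 : (E₃.card : ℝ) ≤ (Fintype.card K + c) * Δ := by
    have hcard : (D.filter fun i => i.1 = v ∨ h i = v).card ≤ Fintype.card K + c := by
      rw [Finset.filter_or]
      exact (Finset.card_union_le _ _).trans (Nat.add_le_add hout (hD.indeg v))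
    calc (E₃.card : ℝ) ≤ ∑ i ∈ D.filter fun i => i.1 = v ∨ h i = v,
          ((blockedAt F v s(i.1, h i)).card : ℝ) := by exact_mod_cast Finset.card_biUnion_le
      _ ≤ ∑ i ∈ D.filter fun i => i.1 = v ∨ h i = v, Δ := by
        refine Finset.sum_le_sum fun i hi => ?_
        rw [Finset.mem_filter] at hi
        refine card_blockedAt_le hF ?_ (hD.adj i hi.1)
        rw [Sym2.mem_iff]
        rcases hi.2 with h' | h'
        · exact Or.inl h'.symm
        · exact Or.inr h'.symm
      _ = (D.filter fun i => i.1 = v ∨ h i = v).card * Δ := by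
        rw [Finset.sum_const, nsmul_eq_mul]
      _ ≤ _ := by
        refine mul_le_mul_of_nonneg_right ?_ hΔ
        exact_mod_cast hcard
  have h4 : E₄.card ≤ 2 * (D.filter fun i => Spoils F v i.1 (h i)).card := by
    rw [mul_comm, ← smul_eq_mul]
    refine Finset.card_biUnion_le.trans (Finset.sum_le_card_nsmul _ _ _ fun i _ =>
      Finset.card_le_two)
  have hsub : nb G v ⊆ available F c D h v ∪ (E₁ ∪ (E₂ ∪ (E₃ ∪ E₄))) := by
    intro u hu
    by_contra hcon
    simp only [Finset.mem_union, not_or] at hcon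
    obtain ⟨c0, c1, c2, c3, c4⟩ := hcon
    apply c0
    simp only [available, Finset.mem_filter]
    refine ⟨hu, ?_, ?_, ?_⟩
    · intro i hi hiv hiu
      exact c1 (Finset.mem_image.2 ⟨i, Finset.mem_filter.2 ⟨hi, hiv⟩, hiu⟩)
    · by_contra! h'
      exact c2 (Finset.mem_filter.2 ⟨hu, h'⟩)
    · intro i hi hinc
      by_cases hv : i.1 = v ∨ h i = v
      · exact c3 (Finset.mem_biUnion.2 ⟨i, Finset.mem_filter.2 ⟨hi, hv⟩,
          (mem_blockedAt F).2 hinc⟩)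
      · obtain ⟨x, hx, hx'⟩ := exists_common_of_incompatible hinc
        have hxu : x = u := by
          rw [Sym2.mem_iff] at hx hx'
          rcases hx with rfl | hx
          · exact (hv (hx'.imp Eq.symm Eq.symm)).elim
          · exact hx
        subst hxu
        refine c4 (Finset.mem_biUnion.2 ⟨i, Finset.mem_filter.2 ⟨hi, ?_⟩, ?_⟩)
        · rw [Sym2.mem_iff] at hx'
          rcases hx' with rfl | rfl
          · exact Or.inr hinc
          · exact Or.inl hinc
        · simpa [Sym2.mem_iff] using hx'
  have hc := Finset.card_le_card hsub
  have u1 := Finset.card_union_le (available F c D h v) (E₁ ∪ (E₂ ∪ (E₃ ∪ E₄)))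
  have u2 := Finset.card_union_le E₁ (E₂ ∪ (E₃ ∪ E₄))
  have u3 := Finset.card_union_le E₂ (E₃ ∪ E₄)
  have u4 := Finset.card_union_le E₃ E₄
  have hall : (nb G v).card ≤ (available F c D h v).card + Fintype.card K + E₂.card + E₃.card +
      2 * (D.filter fun i => Spoils F v i.1 (h i)).card := by omega
  have hall' : ((nb G v).card : ℝ) ≤ (available F c D h v).card + Fintype.card K + E₂.card +
      E₃.card + 2 * (D.filter fun i => Spoils F v i.1 (h i)).card := by exact_mod_cast hall
  linarith

open Classical in
theorem mul_card_saturated_le {c : ℕ} {D : Finset (V × K)} {h : V × K → V} (v : V) :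
    c * ((nb G v).filter fun u => c ≤ (D.filter fun i => h i = u).card).card ≤
      (D.filter fun i => h i ∈ nb G v).card := by
  set S := (nb G v).filter fun u => c ≤ (D.filter fun i => h i = u).card with hS
  calc c * S.card = S.card • c := by rw [smul_eq_mul, mul_comm]
    _ ≤ ∑ u ∈ S, (D.filter fun i => h i = u).card :=
      Finset.card_nsmul_le_sum _ _ _ fun u hu => (Finset.mem_filter.1 hu).2
    _ = (S.biUnion fun u => D.filter fun i => h i = u).card := by
      refine (Finset.card_biUnion fun u _ u' _ hne => ?_).symm
      refine Finset.disjoint_left.2 fun i hi hi' => ?_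
      exact hne ((Finset.mem_filter.1 hi).2.symm.trans (Finset.mem_filter.1 hi').2)
    _ ≤ _ := by
      refine Finset.card_le_card fun i hi => ?_
      obtain ⟨u, hu, hi⟩ := Finset.mem_biUnion.1 hi
      rw [Finset.mem_filter] at hi ⊢
      exact ⟨hi.1, hi.2 ▸ (Finset.mem_filter.1 hu).1⟩

end SparseExpander

/-! ### Exponential potentials and the compatible picks -/

namespace SparseExpander

theorem prod_ite_exp_one {ι : Type*} (D : Finset ι) (p : ι → Prop) [DecidablePred p] :
    ∏ j ∈ D, (if p j then Real.exp 1 else 1) = Real.exp ((D.filter p).card : ℝ) := by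
  rw [Finset.prod_ite, Finset.prod_const, Finset.prod_const_one, mul_one, ← Real.exp_nat_mul,
    mul_one]

/-- Since e ≤ 3, the summand is at most 1 + 2·1[p], and 1 + y ≤ exp y. Replacing A by N in the
exponent makes the bound independent of earlier picks, as the factors g of `exists_choice` require.
-/
theorem sum_ite_exp_one_le {U : Type*} {N A : Finset U} {a : ℝ} (ha : 0 < a) (hAN : A ⊆ N)
    (hA : a ≤ A.card) (p : U → Prop) [DecidablePred p] :
    ∑ u ∈ A, (if p u then Real.exp 1 else 1) ≤
      A.card * Real.exp (2 * (N.filter p).card / a) := by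
  have h1 : ∀ u ∈ A, (if p u then Real.exp 1 else 1) ≤ 1 + 2 * (if p u then (1 : ℝ) else 0) := by
    intro u _
    have := Real.exp_one_lt_d9
    split_ifs <;> linarith
  have h2 : ((A.filter p).card : ℝ) ≤ (N.filter p).card := by
    exact_mod_cast Finset.card_le_card (Finset.filter_subset_filter p hAN)
  calc ∑ u ∈ A, (if p u then Real.exp 1 else 1)
      ≤ ∑ u ∈ A, (1 + 2 * (if p u then (1 : ℝ) else 0)) := Finset.sum_le_sum h1
    _ = A.card + 2 * (A.filter p).card := by
      rw [Finset.sum_add_distrib, ← Finset.mul_sum, Finset.sum_boole]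
      simp
    _ ≤ A.card + 2 * (N.filter p).card := by linarith
    _ ≤ A.card * (2 * (N.filter p).card / a + 1) := by
      have h3 : 2 * ((N.filter p).card : ℝ) = a * (2 * (N.filter p).card / a) := by
        field_simp
      have h4 : a * (2 * ((N.filter p).card : ℝ) / a) ≤ A.card * (2 * (N.filter p).card / a) :=
        mul_le_mul_of_nonneg_right hA (by positivity)
      linarith
    _ ≤ _ := mul_le_mul_of_nonneg_left (Real.add_one_le_exp _) (Nat.cast_nonneg _)

variable {V : Type*} [Fintype V] [DecidableEq V] {G : SimpleGraph V} {F : IncompatibilitySystem G}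

open Classical in
theorem sum_card_common_le {d : ℝ} (hd : 0 < d) (hdeg : ∀ v, ((nb G v).card : ℝ) ≤ 4 * d) (w : V) :
    (∑ x, ((nb G x).filter fun u => u ∈ nb G w).card : ℝ) ≤ 16 * d ^ 2 := by
  have h1 : ∑ x, ((nb G x).filter fun u => u ∈ nb G w).card ≤ ∑ u ∈ nb G w, (nb G u).card := by
    rw [← Finset.card_sigma, ← Finset.card_sigma]
    refine Finset.card_le_card_of_injOn (fun q => ⟨q.2, q.1⟩) ?_ ?_
    · rintro ⟨x, u⟩ hq
      simp only [Finset.coe_sigma, Set.mem_sigma_iff, Finset.mem_coe, Finset.mem_univ,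
        Finset.mem_filter, mem_nb, true_and] at hq ⊢
      exact ⟨hq.2, hq.1.symm⟩
    · rintro ⟨x, u⟩ _ ⟨x', u'⟩ _ h
      simp only [Sigma.mk.injEq, heq_eq_eq] at h
      simp [h.1, h.2]
  calc (∑ x, ((nb G x).filter fun u => u ∈ nb G w).card : ℝ)
      ≤ ∑ u ∈ nb G w, ((nb G u).card : ℝ) := by exact_mod_cast h1
    _ ≤ (nb G w).card • (4 * d) := Finset.sum_le_card_nsmul _ _ _ fun u _ => hdeg u
    _ ≤ 16 * d ^ 2 := by
      rw [nsmul_eq_mul]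
      nlinarith [hdeg w]

open Classical in
/-- Every vertex can pick 54 edges such that all picks are compatible and, for every pair `(S, T)` of
a family of small total weight, some vertex of `S` picks a vertex outside `T`. -/
theorem exists_valid {d Δ : ℝ} (hd : 10 ^ 4 ≤ d) (hF : F.IsBounded Δ) (hΔ : 0 ≤ Δ)
    (hΔd : 10 ^ 10 * Δ ≤ d) (hlow : ∀ v, d / 4 ≤ (nb G v).card)
    (hup : ∀ v, ((nb G v).card : ℝ) ≤ 4 * d)
    (hn : 4 * (Fintype.card V : ℝ) * Real.exp (-(d / 100)) ≤ 1)
    (𝓕 : Finset (Finset V × Finset V))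
    (h𝓕 : ∑ q ∈ 𝓕, ∏ i : V × Fin 54,
      (if i.1 ∈ q.1 then 8 * ((nb G i.1).filter (· ∈ q.2)).card / d else 1) ≤ 1 / 4) :
    ∃ h : V × Fin 54 → V, Valid F 450000 Finset.univ h ∧
      ∀ q ∈ 𝓕, ∃ i : V × Fin 54, i.1 ∈ q.1 ∧ h i ∉ q.2 := by
  have hd0 : 0 < d := by linarith
  -- Three families of potentials. The first keeps the picks spoiling v below d/64, the second keeps
  -- the picks landing in N(v) below 14000d, and the third tests whether all picks from S land in T.
  -- A weight exp(-θ) forces the counter in the exponent below θ as long as the total is below 1.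
  let w : V ⊕ V ⊕ 𝓕 → ℝ := Sum.elim (fun _ => Real.exp (-(d / 64)))
    (Sum.elim (fun _ => Real.exp (-(14000 * d))) fun _ => 1)
  let f : V ⊕ V ⊕ 𝓕 → V × Fin 54 → V → ℝ := Sum.elim
    (fun w i u => if Spoils F w i.1 u then Real.exp 1 else 1)
    (Sum.elim (fun w _ u => if u ∈ nb G w then Real.exp 1 else 1)
      fun q i u => if i.1 ∈ q.1.1 then if u ∈ q.1.2 then 1 else 0 else 1)
  let g : V ⊕ V ⊕ 𝓕 → V × Fin 54 → ℝ := Sum.elim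
    (fun w i => Real.exp (2 * (spoilers F w i.1).card / (d / 8)))
    (Sum.elim (fun w i => Real.exp (2 * ((nb G i.1).filter fun u => u ∈ nb G w).card / (d / 8)))
      fun q i => if i.1 ∈ q.1.1 then 8 * ((nb G i.1).filter (· ∈ q.1.2)).card / d else 1)
  have hw : ∀ k, 0 ≤ w k := by
    rintro (v | v | q) <;> simp only [w, Sum.elim_inl, Sum.elim_inr] <;> positivity
  have hf : ∀ k i u, 0 ≤ f k i u := by
    rintro (v | v | q) i u <;> simp only [f, Sum.elim_inl, Sum.elim_inr] <;> split_ifs <;> positivity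
  have hg : ∀ k i, 0 ≤ g k i := by
    rintro (v | v | q) i <;> simp only [g, Sum.elim_inl, Sum.elim_inr] <;> (try split_ifs) <;>
      positivity
  have hnonneg : ∀ (D : Finset (V × Fin 54)) (h : V × Fin 54 → V) k,
      0 ≤ w k * ((∏ j ∈ D, f k j (h j)) * ∏ j ∈ Dᶜ, g k j) := fun D h k =>
    mul_nonneg (hw k) (mul_nonneg (Finset.prod_nonneg fun _ _ => hf _ _ _)
      (Finset.prod_nonneg fun _ _ => hg _ _))
  have H : ∃ h : V × Fin 54 → V, Valid F 450000 Finset.univ h ∧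
      ∑ k, w k * ∏ j, f k j (h j) < 1 := by
    refine exists_choice w hw f hf g hg (fun D h => Valid F 450000 D h) (fun i => i.1)
      (by constructor <;> simp) ?_ ?_
    · intro D h i hi hD hlt
      have hterm : ∀ k, w k * ((∏ j ∈ D, f k j (h j)) * ∏ j ∈ Dᶜ, g k j) < 1 := fun k =>
        (Finset.single_le_sum (f := fun k => w k * ((∏ j ∈ D, f k j (h j)) * ∏ j ∈ Dᶜ, g k j))
          (fun k _ => hnonneg D h k) (Finset.mem_univ k)).trans_lt hlt
      have hcount : ∀ (θ X Y : ℝ), 1 ≤ Y → Real.exp (-θ) * (Real.exp X * Y) < 1 → X < θ := by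
        intro θ X Y hY h1
        have h2 : Real.exp (-θ) * Real.exp X < 1 := by
          refine lt_of_le_of_lt ?_ h1
          refine mul_le_mul_of_nonneg_left ?_ (Real.exp_pos _).le
          exact le_mul_of_one_le_right (Real.exp_pos _).le hY
        rw [← Real.exp_add, Real.exp_lt_one_iff] at h2
        linarith
      have hX : ((D.filter fun j => Spoils F i.1 j.1 (h j)).card : ℝ) < d / 64 := by
        have h1 := hterm (Sum.inl i.1)
        simp only [w, f, g, Sum.elim_inl] at h1
        rw [prod_ite_exp_one, ← Real.exp_sum] at h1
        exact hcount _ _ _ (Real.one_le_exp (Finset.sum_nonneg fun _ _ => by positivity)) h1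
      have hY : ((D.filter fun j => h j ∈ nb G i.1).card : ℝ) < 14000 * d := by
        have h1 := hterm (Sum.inr (Sum.inl i.1))
        simp only [w, f, g, Sum.elim_inl, Sum.elim_inr] at h1
        rw [prod_ite_exp_one, ← Real.exp_sum] at h1
        exact hcount _ _ _ (Real.one_le_exp (Finset.sum_nonneg fun _ _ => by positivity)) h1
      have hsat : (450000 : ℝ) * ((nb G i.1).filter
          fun u => 450000 ≤ (D.filter fun i => h i = u).card).card ≤
          (D.filter fun j => h j ∈ nb G i.1).card := by
        exact_mod_cast mul_card_saturated_le (c := 450000) (D := D) (h := h) i.1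
      have hav := card_nb_le_card_available hF hΔ hD i.1
      -- Of at least d/4 neighbours, the losses are 54, at most 14000d/450000 saturated ones,
      -- 450054Δ, and at most 2d/64: together less than d/8.
      have hA : d / 8 ≤ (available F 450000 D h i.1).card := by
        have := hlow i.1
        rw [Fintype.card_fin] at hav
        push_cast at hav
        linarith
      have hAN : available F 450000 D h i.1 ⊆ nb G i.1 := available_subset _
      have hA0 : (0 : ℝ) < (available F 450000 D h i.1).card := by linarith
      refine ⟨available F 450000 D h i.1, ?_, ?_, fun u hu => ?_⟩
      · exact Finset.card_pos.1 (by exact_mod_cast hA0)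
      · rintro (v | v | q) <;> simp only [f, g, Sum.elim_inl, Sum.elim_inr]
        · exact sum_ite_exp_one_le (by positivity) hAN hA _
        · exact sum_ite_exp_one_le (by positivity) hAN hA _
        · split_ifs with h1
          · rw [Finset.sum_boole]
            have h2 : (((available F 450000 D h i.1).filter (· ∈ q.1.2)).card : ℝ) ≤
                ((nb G i.1).filter (· ∈ q.1.2)).card := by
              exact_mod_cast Finset.card_le_card (Finset.filter_subset_filter _ hAN)
            refine h2.trans ?_
            rw [mul_div_assoc', le_div_iff₀ hd0]
            nlinarith [Nat.cast_nonneg (α := ℝ) ((nb G i.1).filter (· ∈ q.1.2)).card]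
          · simp
      · convert hD.update hi hu
    · have hsplit : ∀ c : V → ℝ, ∑ i : V × Fin 54, c i.1 = 54 * ∑ x, c x := by
        intro c
        rw [Fintype.sum_prod_type, Finset.mul_sum]
        simp
      have s1 : ∑ v : V, Real.exp (-(d / 64)) *
          ∏ i : V × Fin 54, Real.exp (2 * (spoilers F v i.1).card / (d / 8)) ≤ 1 / 4 := by
        have : ∀ v : V, Real.exp (-(d / 64)) *
            ∏ i : V × Fin 54, Real.exp (2 * (spoilers F v i.1).card / (d / 8)) ≤
              Real.exp (-(d / 100)) := by
          intro v
          rw [← Real.exp_sum, ← Real.exp_add, Real.exp_le_exp,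
            hsplit fun x => 2 * (spoilers F v x).card / (d / 8), ← Finset.sum_div, ← Finset.mul_sum]
          have h1 := sum_card_spoilers_le hF v
          have h2 : (2 * ∑ x, ((spoilers F v x).card : ℝ)) / (d / 8) ≤ 128 * Δ := by
            rw [div_le_iff₀ (by linarith)]
            nlinarith [hup v]
          linarith
        calc _ ≤ ∑ v : V, Real.exp (-(d / 100)) := Finset.sum_le_sum fun v _ => this v
          _ ≤ 1 / 4 := by
            rw [Finset.sum_const, nsmul_eq_mul, Finset.card_univ]
            linarith
      have s2 : ∑ v : V, Real.exp (-(14000 * d)) * ∏ i : V × Fin 54,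
          Real.exp (2 * ((nb G i.1).filter fun u => u ∈ nb G v).card / (d / 8)) ≤ 1 / 4 := by
        have : ∀ v : V, Real.exp (-(14000 * d)) * ∏ i : V × Fin 54,
            Real.exp (2 * ((nb G i.1).filter fun u => u ∈ nb G v).card / (d / 8)) ≤
              Real.exp (-(d / 100)) := by
          intro v
          rw [← Real.exp_sum, ← Real.exp_add, Real.exp_le_exp,
            hsplit fun x => 2 * ((nb G x).filter fun u => u ∈ nb G v).card / (d / 8),
            ← Finset.sum_div, ← Finset.mul_sum]
          have h1 := sum_card_common_le hd0 hup v
          have h2 : (2 * ∑ x, (((nb G x).filter fun u => u ∈ nb G v).card : ℝ)) / (d / 8) ≤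
              256 * d := by
            rw [div_le_iff₀ (by linarith)]
            nlinarith
          -- 54 · 256 = 13824, which leaves room below 14000.
          linarith
        calc _ ≤ ∑ v : V, Real.exp (-(d / 100)) := Finset.sum_le_sum fun v _ => this v
          _ ≤ 1 / 4 := by
            rw [Finset.sum_const, nsmul_eq_mul, Finset.card_univ]
            linarith
      rw [Fintype.sum_sum_type, Fintype.sum_sum_type]
      simp only [w, g, Sum.elim_inl, Sum.elim_inr, one_mul]
      rw [Finset.sum_coe_sort 𝓕 fun q => ∏ i : V × Fin 54,
        (if i.1 ∈ q.1 then 8 * (((nb G i.1).filter (· ∈ q.2)).card : ℝ) / d else 1)]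
      linarith
  obtain ⟨h, hV, hlt⟩ := H
  refine ⟨h, hV, ?_⟩
  intro q hq
  by_contra! hcon
  have h1 : w (Sum.inr (Sum.inr ⟨q, hq⟩)) * ∏ j, f (Sum.inr (Sum.inr ⟨q, hq⟩)) j (h j) < 1 :=
    (Finset.single_le_sum (f := fun k => w k * ∏ j, f k j (h j)) (fun k _ =>
      mul_nonneg (hw k) (Finset.prod_nonneg fun _ _ => hf _ _ _)) (Finset.mem_univ _)).trans_lt hlt
  have h2 : ∏ j, f (Sum.inr (Sum.inr ⟨q, hq⟩)) j (h j) = 1 := by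
    refine Finset.prod_eq_one fun j _ => ?_
    simp only [f, Sum.elim_inr]
    split_ifs with h3 h4
    · rfl
    · exact (h4 (hcon j h3)).elim
    · rfl
  rw [h2] at h1
  simp [w] at h1

end SparseExpander

/-! ### Union bound over traps and the sparse expander -/

namespace SparseExpander

/-- A form of the AM-GM inequality, from y ≤ exp(y - 1) applied to y = x i / A. -/
theorem prod_le_pow_card_of_sum_le {ι : Type*} (S : Finset ι) (x : ι → ℝ) (hx : ∀ i ∈ S, 0 ≤ x i)
    {A : ℝ} (hA : 0 < A) (h : ∑ i ∈ S, x i ≤ A * S.card) : ∏ i ∈ S, x i ≤ A ^ S.card := by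
  have h1 : ∏ i ∈ S, x i / A ≤ 1 := by
    calc ∏ i ∈ S, x i / A ≤ ∏ i ∈ S, Real.exp (x i / A - 1) := by
          refine Finset.prod_le_prod (fun i hi => div_nonneg (hx i hi) hA.le) fun i _ => ?_
          linarith [Real.add_one_le_exp (x i / A - 1)]
      _ = Real.exp (∑ i ∈ S, (x i / A - 1)) := (Real.exp_sum _ _).symm
      _ ≤ 1 := by
        rw [Real.exp_le_one_iff, Finset.sum_sub_distrib, ← Finset.sum_div]
        have : (∑ i ∈ S, x i) / A ≤ S.card := by
          rw [div_le_iff₀ hA]; linarith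
        simpa using this
  rw [Finset.prod_div_distrib, Finset.prod_const, div_le_one (by positivity)] at h1
  exact h1

theorem choose_le_three_mul_div_pow (n t : ℕ) : (n.choose t : ℝ) ≤ (3 * n / t) ^ t := by
  rcases Nat.eq_zero_or_pos t with rfl | ht
  · simp
  have ht' : (0 : ℝ) < t := by exact_mod_cast ht
  have h1 : (t : ℝ) ^ t / t.factorial ≤ 3 ^ t := by
    refine (Real.pow_div_factorial_le_exp t ht'.le t).trans ?_
    rw [← mul_one (t : ℝ), Real.exp_nat_mul]
    exact pow_le_pow_left₀ (Real.exp_pos _).le (by linarith [Real.exp_one_lt_d9]) _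
  calc (n.choose t : ℝ) ≤ n ^ t / t.factorial := Nat.choose_le_pow_div t n
    _ = (n / t) ^ t * (t ^ t / t.factorial) := by
      rw [div_pow]; field_simp
    _ ≤ (n / t) ^ t * 3 ^ t := by gcongr
    _ = _ := by rw [← mul_pow]; ring

theorem sum_card_eq {V : Type*} [Fintype V] (c : ℕ → ℝ) :
    ∑ T : Finset V, c T.card =
      ∑ t ∈ Finset.range (Fintype.card V + 1), ((Fintype.card V).choose t : ℝ) * c t := by
  classical
  rw [← Finset.powerset_univ, Finset.sum_powerset_apply_card, Finset.card_univ]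
  simp [nsmul_eq_mul]

/-- A union bound over the nonempty vertex sets of size at most `n / 10 ^ 5`. -/
theorem sum_small_sets_le {V : Type*} [Fintype V] (c : ℕ → ℝ) {B q : ℝ}
    (hq : 0 ≤ q) (hq1 : q ≤ 1 / 8) (hB : 0 ≤ B)
    (hc : ∀ t : ℕ, 1 ≤ t → (10 ^ 5 * t : ℝ) ≤ Fintype.card V →
      (3 * Fintype.card V / t : ℝ) ^ t * c t ≤ B * q ^ t)
    (hc0 : ∀ t, 0 ≤ c t) :
    ∑ T : Finset V, (if 1 ≤ T.card ∧ (10 ^ 5 * T.card : ℝ) ≤ Fintype.card V then c T.card else 0) ≤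
      B / 4 := by
  rw [sum_card_eq fun t => if 1 ≤ t ∧ (10 ^ 5 * t : ℝ) ≤ Fintype.card V then c t else 0]
  have h1 : ∀ t ∈ Finset.range (Fintype.card V + 1), ((Fintype.card V).choose t : ℝ) *
      (if 1 ≤ t ∧ (10 ^ 5 * t : ℝ) ≤ Fintype.card V then c t else 0) ≤
      if t = 0 then 0 else B * q ^ t := by
    intro t _
    split_ifs with h h0 h0
    · omega
    · exact (mul_le_mul_of_nonneg_right (choose_le_three_mul_div_pow _ _) (hc0 t)).trans
        (hc t h.1 h.2)
    · simp
    · rw [mul_zero]; positivity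
  refine (Finset.sum_le_sum h1).trans ?_
  rw [Finset.sum_range_succ', if_pos rfl, add_zero]
  simp only [Nat.succ_ne_zero, if_false, pow_succ]
  have h2 : ∑ k ∈ Finset.range (Fintype.card V), q ^ k ≤ 2 := by
    have h3 := mul_neg_geom_sum q (Fintype.card V)
    have h4 : 0 ≤ q ^ Fintype.card V := by positivity
    nlinarith [Finset.sum_nonneg fun k (_ : k ∈ Finset.range (Fintype.card V)) => pow_nonneg hq k]
  calc _ = B * q * ∑ k ∈ Finset.range (Fintype.card V), q ^ k := by
        rw [Finset.mul_sum]
        exact Finset.sum_congr rfl fun k _ => by ring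
    _ ≤ B * q * 2 := by gcongr
    _ ≤ B / 4 := by nlinarith

variable {V : Type*} [Fintype V] [DecidableEq V] {G : SimpleGraph V} {F : IncompatibilitySystem G}

/-- No small vertex set spans many edges of `G`. -/
def LocallySparse (G : SimpleGraph V) (d : ℝ) : Prop :=
  ∀ T : Finset V, 1 ≤ T.card → (10 ^ 5 * T.card : ℝ) ≤ Fintype.card V →
    ((hits G (pairsIn T)).card : ℝ) ≤
      max 8 (d * Real.sqrt (T.card / Fintype.card V)) * T.card

open Classical in
/-- The pairs of a small set and a set three times as large that could contain its neighbours. -/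
noncomputable def traps (V : Type*) [Fintype V] (d : ℝ) : Finset (Finset V × Finset V) :=
  Finset.univ.filter fun q => q.1 ⊆ q.2 ∧ q.2.card = 3 * q.1.card ∧ 1 ≤ q.2.card ∧
    (10 ^ 5 * q.2.card : ℝ) ≤ Fintype.card V ∧
    8 < d * Real.sqrt (q.2.card / Fintype.card V)

-- With τ = |T|/n, local sparsity bounds the average over v in S of 8|N(v) ∩ T|/d by 16√τ·|T|/|S| =
-- 48√τ. By AM-GM the weight is at most (48√τ) to the power 54|S| = 18|T|.
open Classical in
theorem trap_weight_le {d : ℝ} (hd : 0 < d) (hG : LocallySparse G d)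
    {q : Finset V × Finset V} (hq : q ∈ traps V d) :
    ∏ i : V × Fin 54, (if i.1 ∈ q.1 then 8 * ((nb G i.1).filter (· ∈ q.2)).card / d else 1) ≤
      (48 ^ 18 * ((q.2.card : ℝ) / Fintype.card V) ^ 9) ^ q.2.card := by
  obtain ⟨S, T⟩ := q
  simp only [traps, Finset.mem_filter, Finset.mem_univ, true_and] at hq
  obtain ⟨hST, hcard, h1, hsmall, h8⟩ := hq
  simp only
  set τ : ℝ := (T.card : ℝ) / Fintype.card V with hτ
  have hτ0 : 0 ≤ τ := by positivity
  have hsq : 0 < Real.sqrt τ := by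
    by_contra! h
    have : Real.sqrt τ = 0 := le_antisymm h (Real.sqrt_nonneg _)
    rw [this] at h8
    norm_num at h8
  have hcR : (T.card : ℝ) = 3 * S.card := by exact_mod_cast hcard
  have hsum : ∑ v ∈ S, (8 * ((nb G v).filter (· ∈ T)).card / d : ℝ) ≤
      48 * Real.sqrt τ * S.card := by
    have e1 : (∑ v ∈ S, ((nb G v).filter (· ∈ T)).card : ℝ) ≤ 2 * (hits G (pairsIn T)).card := by
      have := card_le_two_mul_card_hits (G := G)
        ((S.sigma fun v => (nb G v).filter (· ∈ T)).image fun q => (q.1, q.2)) T (by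
          intro q hq
          simp only [Finset.mem_image, Finset.mem_sigma, Finset.mem_filter, mem_nb] at hq
          obtain ⟨⟨a, b⟩, ⟨h1, h2, h3⟩, rfl⟩ := hq
          exact ⟨h2, hST h1, h3⟩)
      rw [Finset.card_image_of_injective, Finset.card_sigma] at this
      · exact_mod_cast this
      · rintro ⟨a, b⟩ ⟨a', b'⟩ h
        simpa using h
    have e2 := hG T h1 hsmall
    rw [max_eq_right h8.le, hcR] at e2
    rw [← Finset.sum_div, ← Finset.mul_sum, div_le_iff₀ hd]
    nlinarith
  have hprod := prod_le_pow_card_of_sum_le S (fun v => 8 * ((nb G v).filter (· ∈ T)).card / d)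
    (fun v _ => by positivity) (by positivity) hsum
  calc ∏ i : V × Fin 54, (if i.1 ∈ S then 8 * ((nb G i.1).filter (· ∈ T)).card / d else 1)
      = (∏ v ∈ S, (8 * ((nb G v).filter (· ∈ T)).card / d : ℝ)) ^ 54 := by
        rw [Fintype.prod_prod_type, ← Finset.prod_pow, ← Finset.prod_filter_mul_prod_filter_not
          Finset.univ (· ∈ S)]
        rw [Finset.filter_mem_eq_inter, Finset.univ_inter]
        rw [Finset.prod_congr rfl fun v (hv : v ∈ S) => Finset.prod_congr rfl
          fun j _ => if_pos hv, Finset.prod_eq_one (s := Finset.univ.filter (· ∉ S)) fun v hv =>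
            Finset.prod_eq_one fun j _ => if_neg (Finset.mem_filter.1 hv).2]
        simp only [Finset.prod_const, Finset.card_univ, Fintype.card_fin, mul_one]
    _ ≤ ((48 * Real.sqrt τ) ^ S.card) ^ 54 :=
        pow_le_pow_left₀ (Finset.prod_nonneg fun v _ => by positivity) hprod _
    _ = (48 ^ 18 * τ ^ 9) ^ T.card := by
      rw [hcard, pow_mul _ 3, ← pow_mul, mul_comm S.card, pow_mul]
      congr 1
      have : τ = Real.sqrt τ ^ 2 := (Real.sq_sqrt hτ0).symm
      conv_rhs => rw [this]
      ring

-- Each T has at most 2^|T| subsets S, and there are at most (3/τ)^t sets T of size t. The base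
-- 6·48^18·τ^8 is tiny because τ ≤ 10^-5.
open Classical in
theorem sum_trap_weight_le {d : ℝ} (hd : 0 < d) (hG : LocallySparse G d) :
    ∑ q ∈ traps V d, ∏ i : V × Fin 54,
      (if i.1 ∈ q.1 then 8 * ((nb G i.1).filter (· ∈ q.2)).card / d else 1) ≤ 1 / 4 := by
  let b : ℕ → ℝ := fun t => (48 ^ 18 * ((t : ℝ) / Fintype.card V) ^ 9) ^ t
  have hb0 : ∀ t, 0 ≤ b t := fun t => by positivity
  refine (Finset.sum_le_sum fun q hq => trap_weight_le hd hG hq).trans ?_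
  rw [← Finset.sum_fiberwise (traps V d) Prod.snd]
  have hfib : ∀ T : Finset V, ∑ q ∈ (traps V d).filter fun q => q.2 = T,
      (48 ^ 18 * ((q.2.card : ℝ) / Fintype.card V) ^ 9) ^ q.2.card ≤
      if 1 ≤ T.card ∧ (10 ^ 5 * T.card : ℝ) ≤ Fintype.card V then 2 ^ T.card * b T.card else 0 := by
    intro T
    split_ifs with h
    · have hle : ((traps V d).filter fun q => q.2 = T).card ≤ 2 ^ T.card := by
        rw [← Finset.card_powerset]
        refine Finset.card_le_card_of_injOn Prod.fst ?_ ?_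
        · intro q hq
          simp only [traps, Finset.coe_filter, Finset.mem_filter, Finset.mem_univ, true_and,
            Set.mem_ofPred_eq] at hq
          simpa [← hq.2] using hq.1.1
        · intro q hq q' hq' e
          simp only [Finset.coe_filter, Set.mem_ofPred_eq] at hq hq'
          exact Prod.ext e (hq.2.trans hq'.2.symm)
      calc _ ≤ ((traps V d).filter fun q => q.2 = T).card • b T.card := by
            refine Finset.sum_le_card_nsmul _ _ _ fun q hq => ?_
            rw [(Finset.mem_filter.1 hq).2]
        _ ≤ _ := by
          rw [nsmul_eq_mul]
          refine mul_le_mul_of_nonneg_right ?_ (hb0 _)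
          exact_mod_cast hle
    · refine (Finset.sum_eq_zero fun q hq => (h ?_).elim).le
      simp only [traps, Finset.mem_filter, Finset.mem_univ, true_and] at hq
      rw [← hq.2]
      exact ⟨hq.1.2.2.1, hq.1.2.2.2.1⟩
  refine (Finset.sum_le_sum fun T _ => hfib T).trans ?_
  refine sum_small_sets_le (fun t => 2 ^ t * b t) (B := 1) (q := 1 / 8) (by norm_num) le_rfl
    zero_le_one ?_ (fun t => mul_nonneg (by positivity) (hb0 t))
  intro t ht htn
  have ht' : (0 : ℝ) < t := by exact_mod_cast ht
  have hn : (0 : ℝ) < Fintype.card V := by nlinarith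
  simp only [b]
  rw [← mul_pow, ← mul_pow, one_mul]
  refine pow_le_pow_left₀ (by positivity) ?_ _
  have hτ : (t : ℝ) / Fintype.card V ≤ 1 / 10 ^ 5 := by
    rw [div_le_div_iff₀ hn (by norm_num)]; linarith
  calc (3 * Fintype.card V / t : ℝ) * (2 * (48 ^ 18 * ((t : ℝ) / Fintype.card V) ^ 9))
      = 6 * 48 ^ 18 * ((t : ℝ) / Fintype.card V) ^ 8 := by field_simp; ring
    _ ≤ 6 * 48 ^ 18 * (1 / 10 ^ 5) ^ 8 := by gcongr
    _ ≤ 1 / 8 := by norm_num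

/-- A graph with suitable degrees and local sparsity contains a compatible sparse expander. -/
theorem exists_compatible_expander {d Δ : ℝ} (hd : 10 ^ 4 ≤ d) (hF : F.IsBounded Δ) (hΔ : 0 ≤ Δ)
    (hΔd : 10 ^ 10 * Δ ≤ d) (hlow : ∀ v, d / 4 ≤ (nb G v).card)
    (hup : ∀ v, ((nb G v).card : ℝ) ≤ 4 * d)
    (hn : 4 * (Fintype.card V : ℝ) * Real.exp (-(d / 100)) ≤ 1) (hG : LocallySparse G d)
    {m : ℕ} (hm : 3 * 10 ^ 5 * m ≤ Fintype.card V) :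
    ∃ Γ : SimpleGraph V, Γ ≤ G ∧ PathList.Expands Γ m ∧
      Γ.edgeSet.ncard ≤ 54 * Fintype.card V ∧
      ∀ e ∈ Γ.edgeSet, ∀ e' ∈ Γ.edgeSet, ¬ F.Incompatible e e' := by
  classical
  obtain ⟨h, hV, htrap⟩ := exists_valid hd hF hΔ hΔd hlow hup hn (traps V d)
    (by convert sum_trap_weight_le (G := G) (by linarith) hG)
  let E : Finset (Sym2 V) := Finset.univ.image fun i : V × Fin 54 => s(i.1, h i)
  have hE : ∀ e, e ∈ (SimpleGraph.fromEdgeSet (E : Set (Sym2 V))).edgeSet ↔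
      ∃ i : V × Fin 54, s(i.1, h i) = e := by
    intro e
    rw [SimpleGraph.edgeSet_fromEdgeSet]
    constructor
    · rintro ⟨he, -⟩
      simpa [E] using he
    · rintro ⟨i, rfl⟩
      refine ⟨Finset.mem_coe.2 (Finset.mem_image_of_mem _ (Finset.mem_univ i)), ?_⟩
      simpa using (hV.adj i (Finset.mem_univ i)).ne
  refine ⟨SimpleGraph.fromEdgeSet (E : Set (Sym2 V)), ?_, ?_, ?_, ?_⟩
  · rw [← SimpleGraph.edgeSet_subset_edgeSet]
    intro e he
    obtain ⟨i, rfl⟩ := (hE e).1 he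
    exact hV.adj i (Finset.mem_univ i)
  · intro S T₀ hS hSm hST₀ hT₀
    by_contra! hle
    have hSpos : 1 ≤ S.card := hS.card_pos
    obtain ⟨T, hT₀T, hT⟩ := Finset.exists_superset_card_eq hle
      (by omega : 3 * S.card ≤ Fintype.card V)
    have hST : S ⊆ T := hST₀.trans hT₀T
    have hpick : ∀ i : V × Fin 54, i.1 ∈ S → h i ∈ T := fun i hi =>
      hT₀T (hT₀ i.1 hi (h i) ((hE _).2 ⟨i, rfl⟩))
    have hTs : (10 ^ 5 * T.card : ℝ) ≤ Fintype.card V := by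
      have : 10 ^ 5 * T.card ≤ Fintype.card V := by omega
      exact_mod_cast this
    by_cases h8 : 8 < d * Real.sqrt (T.card / Fintype.card V)
    · obtain ⟨i, hi, hi'⟩ := htrap (S, T) (by
        simp only [traps, Finset.mem_filter, Finset.mem_univ, true_and]
        exact ⟨hST, hT, by omega, hTs, h8⟩)
      exact hi' (hpick i hi)
    -- T spans at most 8|T| = 24|S| edges, while the 54|S| distinct picks from S give at least 27|S|
    -- edges inside T.
    · have h1 := hG T (by omega) hTs
      rw [max_eq_left (not_lt.1 h8)] at h1
      have h1' : (hits G (pairsIn T)).card ≤ 8 * T.card := by exact_mod_cast h1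
      have h2 := card_le_two_mul_card_hits (G := G)
        ((S ×ˢ (Finset.univ : Finset (Fin 54))).image fun i => (i.1, h i)) T (by
          intro q hq
          obtain ⟨i, hi, rfl⟩ := Finset.mem_image.1 hq
          have hi' := (Finset.mem_product.1 hi).1
          exact ⟨hV.adj i (Finset.mem_univ i), hST hi', hpick i hi'⟩)
      rw [Finset.card_image_of_injective, Finset.card_product, Finset.card_univ,
        Fintype.card_fin] at h2
      · omega
      · intro i j e
        simp only [Prod.mk.injEq] at e
        exact hV.inj i (Finset.mem_univ i) j (Finset.mem_univ j) e.1 e.2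
  · have h1 : (SimpleGraph.fromEdgeSet (E : Set (Sym2 V))).edgeSet ⊆ (E : Set (Sym2 V)) := by
      rw [SimpleGraph.edgeSet_fromEdgeSet]
      exact Set.sdiff_subset
    have h2 := Set.ncard_le_ncard h1 (Finset.finite_toSet E)
    rw [Set.ncard_coe_finset] at h2
    refine h2.trans (Finset.card_image_le.trans ?_)
    rw [Finset.card_univ, Fintype.card_prod, Fintype.card_fin, mul_comm]
  · intro e he e' he'
    obtain ⟨i, rfl⟩ := (hE e).1 he
    obtain ⟨j, rfl⟩ := (hE e').1 he'
    exact hV.compat i (Finset.mem_univ i) j (Finset.mem_univ j)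

end SparseExpander

/-! ### Adding compatible boosters -/

namespace SparseExpander

open PathList

variable {V : Type*} [Fintype V] {G : SimpleGraph V} {F : IncompatibilitySystem G}

/-- Every sparse graph with many boosters has many boosters among the edges of `G`. -/
def BoosterRich (G : SimpleGraph V) (d : ℝ) : Prop :=
  ∀ Γ : SimpleGraph V, Γ.edgeSet.ncard ≤ 57 * Fintype.card V →
    (Fintype.card V : ℝ) ^ 2 / (2 * 10 ^ 12) ≤ (boosters Γ).card →
    d * Fintype.card V / (4 * 10 ^ 12) ≤ (hits G (boosters Γ)).card

open Classical in
theorem card_incompatible_le {Δ : ℝ} (hF : F.IsBounded Δ) {e : Sym2 V} (he : e ∈ G.edgeSet) :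
    ((Finset.univ.filter fun e' => F.Incompatible e' e).card : ℝ) ≤ 2 * Δ := by
  induction e with
  | h x y =>
  have hsub : (Finset.univ.filter fun e' => F.Incompatible e' s(x, y)) ⊆
      (blockedAt F x s(x, y)).image (fun u => s(x, u)) ∪
        (blockedAt F y s(x, y)).image (fun u => s(y, u)) := by
    intro e' he'
    have hinc := (Finset.mem_filter.1 he').2
    obtain ⟨v, hv, hv'⟩ := exists_common_of_incompatible hinc
    obtain ⟨u, rfl⟩ := Sym2.mem_iff_exists.1 hv
    rw [Finset.mem_union, Finset.mem_image, Finset.mem_image]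
    rcases Sym2.mem_iff.1 hv' with rfl | rfl
    · exact Or.inl ⟨u, (mem_blockedAt F).2 hinc, rfl⟩
    · exact Or.inr ⟨u, (mem_blockedAt F).2 hinc, rfl⟩
  have h1 := (Finset.card_le_card hsub).trans (Finset.card_union_le _ _)
  have h2 : ((Finset.univ.filter fun e' => F.Incompatible e' s(x, y)).card : ℝ) ≤
      (blockedAt F x s(x, y)).card + (blockedAt F y s(x, y)).card := by
    exact_mod_cast h1.trans (Nat.add_le_add Finset.card_image_le Finset.card_image_le)
  have h3 := card_blockedAt_le hF (Sym2.mem_mk_left x y) he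
  have h4 := card_blockedAt_le hF (Sym2.mem_mk_right x y) he
  linarith

/-- At most 57n · 2Δ ≤ 114·10^-15·dn pairs are incompatible with an edge of Γ, while G contains at
least 250·10^-15·dn boosters. -/
theorem exists_compatible_booster {d Δ : ℝ} (hd : 0 < d) (hF : F.IsBounded Δ)
    (hΔ : 0 ≤ Δ) (hΔd : 10 ^ 15 * Δ ≤ d) (hG : BoosterRich G d) [Nonempty V]
    {Γ : SimpleGraph V} (hΓ : Γ ≤ G) (hcard : Γ.edgeSet.ncard ≤ 57 * Fintype.card V)
    (hB : (Fintype.card V : ℝ) ^ 2 / (2 * 10 ^ 12) ≤ (boosters Γ).card) :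
    ∃ e ∈ boosters Γ, e ∈ G.edgeSet ∧ ∀ e' ∈ Γ.edgeSet, ¬ F.Incompatible e e' := by
  classical
  by_contra! hcon
  have hfin : Γ.edgeSet.Finite := Set.toFinite _
  have hn : (0 : ℝ) < Fintype.card V := by exact_mod_cast Fintype.card_pos
  have hsub : hits G (boosters Γ) ⊆
      hfin.toFinset.biUnion fun e' => Finset.univ.filter fun e => F.Incompatible e e' := by
    intro e he
    obtain ⟨h1, h2⟩ := mem_hits.1 he
    obtain ⟨e', he', hinc⟩ := hcon e h1 h2
    exact Finset.mem_biUnion.2 ⟨e', hfin.mem_toFinset.2 he', by simpa using hinc⟩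
  have hc : (hfin.toFinset.card : ℝ) ≤ 57 * Fintype.card V := by
    rw [← Set.ncard_eq_toFinset_card _ hfin]
    exact_mod_cast hcard
  have h1 : ((hits G (boosters Γ)).card : ℝ) ≤ 57 * Fintype.card V * (2 * Δ) := by
    calc ((hits G (boosters Γ)).card : ℝ)
        ≤ ∑ e' ∈ hfin.toFinset,
          ((Finset.univ.filter fun e => F.Incompatible e e').card : ℝ) := by
          exact_mod_cast (Finset.card_le_card hsub).trans Finset.card_biUnion_le
      _ ≤ hfin.toFinset.card • (2 * Δ) := Finset.sum_le_card_nsmul _ _ _ fun e' he' =>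
          card_incompatible_le hF (SimpleGraph.edgeSet_mono hΓ (hfin.mem_toFinset.1 he'))
      _ ≤ _ := by
        rw [nsmul_eq_mul]
        exact mul_le_mul_of_nonneg_right hc (by linarith)
  have h2 := (hG Γ hcard hB).trans h1
  rw [div_le_iff₀ (by norm_num)] at h2
  nlinarith [mul_pos hd hn, mul_nonneg hΔ hn.le]

/-- The deterministic core: a graph with suitable degrees, local sparsity and many boosters has a
compatible Hamilton cycle. -/
theorem hasCompatibleHamiltonCycle [DecidableEq V] {d Δ : ℝ} (hd : 10 ^ 4 ≤ d)
    (hcardV : 10 ^ 6 ≤ Fintype.card V) (hF : F.IsBounded Δ) (hΔ : 0 ≤ Δ)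
    (hΔd : 10 ^ 15 * Δ ≤ d) (hlow : ∀ v, d / 4 ≤ (nb G v).card)
    (hup : ∀ v, ((nb G v).card : ℝ) ≤ 4 * d)
    (hn : 4 * (Fintype.card V : ℝ) * Real.exp (-(d / 100)) ≤ 1) (hG : LocallySparse G d)
    (hG' : BoosterRich G d) : F.HasCompatibleHamiltonCycle := by
  have hd0 : 0 < d := by linarith
  have : Nonempty V := Fintype.card_pos_iff.1 (by omega)
  set m := Fintype.card V / (3 * 10 ^ 5) with hm
  have hm1 : 3 * 10 ^ 5 * m ≤ Fintype.card V := Nat.mul_div_le _ _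
  have hm2 : Fintype.card V ≤ 10 ^ 6 * m := by omega
  have hm0 : 1 ≤ m := by omega
  -- Induction on j, a bound for the `progress` still missing. Every added edge raises `progress`,
  -- so Γ has at most 54n + 2n + 1 ≤ 57n edges throughout; when j = 0 no booster can exist, so there
  -- is a spanning cycle.
  suffices H : ∀ j, ∀ Γ : SimpleGraph V, Γ ≤ G → Expands Γ m →
      Γ.edgeSet.ncard ≤ 54 * Fintype.card V + progress Γ →
      (∀ e ∈ Γ.edgeSet, ∀ e' ∈ Γ.edgeSet, ¬ F.Incompatible e e') →
      2 * Fintype.card V + 1 ≤ progress Γ + j → F.HasCompatibleHamiltonCycle by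
    obtain ⟨Γ, h1, h2, h3, h4⟩ := exists_compatible_expander hd hF hΔ (by linarith) hlow hup hn hG hm1
    exact H (2 * Fintype.card V + 1) Γ h1 h2 (by omega) h4 (by omega)
  intro j
  induction j with
  | zero =>
    intro Γ h1 h2 h3 h4 h5
    by_cases hcyc : ∃ l, IsCycleList Γ l ∧ l.length = Fintype.card V
    · obtain ⟨l, hl, hlen⟩ := hcyc
      obtain ⟨a, c, hc, hsub⟩ := hl.exists_isHamiltonianCycle h1 hlen
      exact ⟨a, c, hc, fun e he e' he' => h4 e (hsub he) e' (hsub he')⟩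
    · exfalso
      have h6 := sq_le_two_mul_card_boosters hm0 h2 hcyc
      have h7 : 0 < (boosters Γ).card := by
        have : 0 < m ^ 2 := by positivity
        omega
      obtain ⟨e, he⟩ := Finset.card_pos.1 h7
      simp only [boosters, Finset.mem_filter, Finset.mem_univ, true_and] at he
      have := progress_le (Γ ⊔ SimpleGraph.fromEdgeSet {e})
      omega
  | succ j ih =>
    intro Γ h1 h2 h3 h4 h5
    by_cases hcyc : ∃ l, IsCycleList Γ l ∧ l.length = Fintype.card V
    · obtain ⟨l, hl, hlen⟩ := hcyc
      obtain ⟨a, c, hc, hsub⟩ := hl.exists_isHamiltonianCycle h1 hlen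
      exact ⟨a, c, hc, fun e he e' he' => h4 e (hsub he) e' (hsub he')⟩
    have h6 := sq_le_two_mul_card_boosters hm0 h2 hcyc
    have h6' : (m : ℝ) ^ 2 ≤ 2 * (boosters Γ).card := by exact_mod_cast h6
    have hm2' : (Fintype.card V : ℝ) ≤ 10 ^ 6 * m := by exact_mod_cast hm2
    have hB : (Fintype.card V : ℝ) ^ 2 / (2 * 10 ^ 12) ≤ (boosters Γ).card := by
      rw [div_le_iff₀ (by norm_num)]
      have := pow_le_pow_left₀ (Nat.cast_nonneg _) hm2' 2
      nlinarith
    have hpr := progress_le Γ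
    obtain ⟨e, heB, heG, hcomp⟩ := exists_compatible_booster hd0 hF hΔ hΔd hG' h1 (by omega) hB
    simp only [boosters, Finset.mem_filter, Finset.mem_univ, true_and] at heB
    obtain ⟨hdiag, hprog⟩ := heB
    have hE : (Γ ⊔ SimpleGraph.fromEdgeSet {e}).edgeSet = insert e Γ.edgeSet := by
      rw [SimpleGraph.edgeSet_sup, SimpleGraph.edgeSet_fromEdgeSet, Set.union_comm,
        Set.insert_eq]
      congr 1
      ext x
      simp only [Set.mem_sdiff, Set.mem_singleton_iff]
      constructor
      · exact fun h => h.1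
      · rintro rfl
        exact ⟨rfl, by simpa using hdiag⟩
    refine ih (Γ ⊔ SimpleGraph.fromEdgeSet {e}) ?_ (h2.mono le_sup_left) ?_ ?_ (by omega)
    · rw [← SimpleGraph.edgeSet_subset_edgeSet, hE]
      exact Set.insert_subset heG (SimpleGraph.edgeSet_mono h1)
    · rw [hE]
      have := Set.ncard_insert_le e Γ.edgeSet
      omega
    · rw [hE]
      rintro e₁ (rfl | h₁) e₂ (rfl | h₂)
      · exact not_incompatible_self F _
      · exact hcomp e₂ h₂
      · exact fun h => hcomp e₁ h₁ (incompatible_comm h)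
      · exact h4 e₁ h₁ e₂ h₂

end SparseExpander

/-! ### Exponential moments in the random graph -/

namespace SparseExpander

open MeasureTheory SimpleGraph

variable {V : Type*} [Fintype V]

theorem binomialRandom_real_singleton (p : unitInterval) (G : SimpleGraph V) :
    (binomialRandom V p).real {G} = (p : ℝ) ^ G.edgeSet.ncard *
      (1 - p : ℝ) ^ ((Fintype.card V).choose 2 - G.edgeSet.ncard) := by
  rw [measureReal_def, binomialRandom_singleton, Nat.card_eq_fintype_card]
  simp

open Classical in
/-- The generating function of the number of random edges in a set of pairs. -/
theorem sum_binomialRandom_mul_pow (p : unitInterval) (B : Finset (Sym2 V))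
    (hB : ∀ e ∈ B, ¬ e.IsDiag) (y : ℝ) :
    ∑ G : SimpleGraph V, (binomialRandom V p).real {G} * y ^ (hits G B).card =
      (1 + p * (y - 1) : ℝ) ^ B.card := by
  set N : Finset (Sym2 V) := Finset.univ.filter fun e => ¬ e.IsDiag with hN
  have hNcard : N.card = (Fintype.card V).choose 2 := by
    rw [← Sym2.card_diagSet_compl, ← Set.toFinset_card]
    congr 1
    ext e
    simp [hN]
  have hBN : B ⊆ N := fun e he => by simpa [hN] using hB e he
  have h1 : ∏ e ∈ N, ((p : ℝ) * (if e ∈ B then y else 1) + (1 - p)) =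
      (1 + p * (y - 1) : ℝ) ^ B.card := by
    have : ∀ e ∈ N, ((p : ℝ) * (if e ∈ B then y else 1) + (1 - p)) =
        if e ∈ B then 1 + p * (y - 1) else 1 := by
      intro e _
      split_ifs <;> ring
    rw [Finset.prod_congr rfl this, Finset.prod_ite_mem, Finset.inter_eq_right.2 hBN,
      Finset.prod_const]
  -- Expanding the product over all pairs gives a sum over sets of pairs, that is, over graphs.
  rw [← h1, Finset.prod_add]
  refine Finset.sum_bij' (fun G _ => Finset.univ.filter (· ∈ G.edgeSet))
    (fun s _ => fromEdgeSet (s : Set (Sym2 V))) ?_ ?_ ?_ ?_ ?_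
  · intro G _
    rw [Finset.mem_powerset]
    intro e he
    have he' := (Finset.mem_filter.1 he).2
    simpa [hN] using G.not_isDiag_of_mem_edgeSet he'
  · simp
  · intro G _
    rw [Finset.coe_filter]
    simp
  · intro s hs
    have hs' := Finset.mem_powerset.1 hs
    ext e
    simp only [edgeSet_fromEdgeSet, Finset.mem_filter, Finset.mem_univ, true_and]
    constructor
    · exact fun h => h.1
    · intro h
      exact ⟨h, by simpa [hN] using hs' h⟩
  · intro G _
    set s : Finset (Sym2 V) := Finset.univ.filter (· ∈ G.edgeSet) with hs
    have hcoe : (s : Set (Sym2 V)) = G.edgeSet := by rw [hs, Finset.coe_filter]; simp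
    have hsN : s ⊆ N := by
      intro e he
      have he' := (Finset.mem_filter.1 he).2
      simpa [hN] using G.not_isDiag_of_mem_edgeSet he'
    have hhits : hits G B = s.filter (· ∈ B) := by
      ext e
      simp [hits, hs, and_comm]
    rw [binomialRandom_real_singleton, ← hcoe, Set.ncard_coe_finset, hhits,
      Finset.prod_mul_distrib, Finset.prod_const, Finset.prod_const, Finset.prod_ite,
      Finset.prod_const, Finset.prod_const_one, Finset.card_sdiff_of_subset hsN, hNcard]
    ring

open Classical in
theorem binomialRandom_real_le (p : unitInterval) (A : Set (SimpleGraph V)) (φ : SimpleGraph V → ℝ)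
    (h0 : ∀ G, 0 ≤ φ G) (h1 : ∀ G ∈ A, 1 ≤ φ G) :
    (binomialRandom V p).real A ≤ ∑ G : SimpleGraph V, (binomialRandom V p).real {G} * φ G := by
  have hA : A = ⋃ G ∈ (Finset.univ.filter (· ∈ A) : Finset (SimpleGraph V)), {G} := by
    ext G; simp
  calc (binomialRandom V p).real A
      = (binomialRandom V p).real
        (⋃ G ∈ (Finset.univ.filter (· ∈ A) : Finset (SimpleGraph V)), {G}) := by rw [← hA]
    _ ≤ ∑ G ∈ Finset.univ.filter (· ∈ A), (binomialRandom V p).real {G} :=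
      measureReal_biUnion_finset_le _ _
    _ ≤ ∑ G ∈ Finset.univ.filter (· ∈ A), (binomialRandom V p).real {G} * φ G :=
      Finset.sum_le_sum fun G hG =>
        le_mul_of_one_le_right measureReal_nonneg (h1 G (Finset.mem_filter.1 hG).2)
    _ ≤ _ := Finset.sum_le_sum_of_subset_of_nonneg (Finset.filter_subset _ _) fun G _ _ =>
        mul_nonneg measureReal_nonneg (h0 G)

/-- Chernoff's bound, for both tails according to the sign of `l`. -/
theorem binomialRandom_tail_le (p : unitInterval) (B : Finset (Sym2 V))
    (hB : ∀ e ∈ B, ¬ e.IsDiag) (l m : ℝ) :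
    (binomialRandom V p).real {G | l * m ≤ l * (hits G B).card} ≤
      Real.exp (B.card * p * (Real.exp l - 1) - l * m) := by
  refine (binomialRandom_real_le p _
    (fun G => Real.exp (-(l * m)) * Real.exp l ^ (hits G B).card) (fun G => by positivity)
    fun G hG => ?_).trans ?_
  · rw [← Real.exp_nat_mul, ← Real.exp_add]
    refine Real.one_le_exp ?_
    rw [Set.mem_ofPred_eq] at hG
    linarith
  · have : ∀ G : SimpleGraph V, (binomialRandom V p).real {G} *
        (Real.exp (-(l * m)) * Real.exp l ^ (hits G B).card) =
        Real.exp (-(l * m)) * ((binomialRandom V p).real {G} * Real.exp l ^ (hits G B).card) :=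
      fun G => by ring
    rw [Finset.sum_congr rfl fun G _ => this G, ← Finset.mul_sum,
      sum_binomialRandom_mul_pow p B hB,
      show (B.card : ℝ) * p * (Real.exp l - 1) - l * m =
        -(l * m) + B.card * ((p : ℝ) * (Real.exp l - 1)) by ring,
      Real.exp_add, Real.exp_nat_mul]
    refine mul_le_mul_of_nonneg_left ?_ (Real.exp_pos _).le
    refine pow_le_pow_left₀ ?_ ?_ _
    · nlinarith [p.2.1, p.2.2, Real.exp_pos l]
    · linarith [Real.add_one_le_exp ((p : ℝ) * (Real.exp l - 1))]

theorem card_pairsIn_le (T : Finset V) : ((pairsIn T).card : ℝ) ≤ (T.card : ℝ) ^ 2 / 2 := by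
  classical
  have h1 : pairsIn T ⊆ T.offDiag.image fun q : V × V => s(q.1, q.2) := by
    intro e he
    induction e with
    | h x y =>
    obtain ⟨h1, h2, h3⟩ := mem_pairsIn.1 he
    exact Finset.mem_image.2 ⟨(x, y), Finset.mem_offDiag.2 ⟨h2, h3, h1⟩, rfl⟩
  have h2 : (pairsIn T).card ≤ T.card.choose 2 := by
    refine (Finset.card_le_card h1).trans_eq ?_
    exact Sym2.card_image_offDiag T
  have h3 : ((T.card.choose 2 : ℕ) : ℝ) ≤ (T.card : ℝ) ^ 2 / 2 := by
    rw [Nat.cast_choose_two]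
    nlinarith [Nat.cast_nonneg (α := ℝ) T.card]
  exact le_trans (by exact_mod_cast h2) h3

/-- All factors but one are at most 1/2, and t ≤ 2^(t-1). This supplies the 1/n that makes the union
bound over small sets vanish. -/
theorem div_pow_self_le {t n : ℕ} (ht : 1 ≤ t) (htn : 2 * t ≤ n) :
    ((t : ℝ) / n) ^ t ≤ 1 / n := by
  have hn : (0 : ℝ) < n := by exact_mod_cast (by omega : 0 < n)
  obtain ⟨k, rfl⟩ : ∃ k, t = k + 1 := ⟨t - 1, by omega⟩
  have h1 : ((k + 1 : ℕ) : ℝ) / n ≤ 1 / 2 := by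
    rw [div_le_div_iff₀ hn (by norm_num)]
    exact_mod_cast (by omega : (k + 1) * 2 ≤ 1 * n)
  have h2 : ((k + 1 : ℕ) : ℝ) * (1 / 2) ^ k ≤ 1 := by
    rw [one_div, inv_pow, ← div_eq_mul_inv, div_le_one (by positivity)]
    exact_mod_cast Nat.lt_two_pow_self (n := k)
  calc (((k + 1 : ℕ) : ℝ) / n) ^ (k + 1)
      = (((k + 1 : ℕ) : ℝ) / n) ^ k * (((k + 1 : ℕ) : ℝ) / n) := pow_succ _ _
    _ ≤ (1 / 2) ^ k * (((k + 1 : ℕ) : ℝ) / n) := by gcongr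
    _ = (((k + 1 : ℕ) : ℝ) * (1 / 2) ^ k) / n := by ring
    _ ≤ 1 / n := by gcongr

/-- A set is encoded by a listing of its elements, padded with `none` to length M. -/
theorem card_small_finsets_le {α : Type*} [Fintype α] [DecidableEq α] (M : ℕ) :
    ((Finset.univ : Finset (Finset α)).filter fun s => s.card ≤ M).card ≤
      (Fintype.card α + 1) ^ M := by
  have : (Fintype.card α + 1) ^ M = (Finset.univ : Finset (Fin M → Option α)).card := by simp
  rw [this]
  refine Finset.card_le_card_of_injOn (fun s i => s.toList[(i : ℕ)]?) (by simp) ?_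
  intro s hs s' hs' h
  simp only [Finset.coe_filter, Finset.mem_univ, true_and, Set.mem_ofPred_eq] at hs hs'
  have key : ∀ i : ℕ, s.toList[i]? = s'.toList[i]? := by
    intro i
    by_cases hi : i < M
    · exact congrFun h ⟨i, hi⟩
    · rw [List.getElem?_eq_none (by rw [Finset.length_toList]; omega),
        List.getElem?_eq_none (by rw [Finset.length_toList]; omega)]
  have : s.toList = s'.toList := List.ext_getElem? key
  ext x
  rw [← Finset.mem_toList, this, Finset.mem_toList]

end SparseExpander

/-! ### Typical properties of the random graph -/

namespace SparseExpander

open MeasureTheory SimpleGraph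

variable {V : Type*} [Fintype V]

theorem binomialRandom_real_iUnion_le {ι : Type*} [Fintype ι] (p : unitInterval)
    (A : ι → Set (SimpleGraph V)) {B : Set (SimpleGraph V)} (h : ∀ G ∈ B, ∃ i, G ∈ A i) :
    (binomialRandom V p).real B ≤ ∑ i, (binomialRandom V p).real (A i) := by
  refine (measureReal_mono (fun G hG => ?_) (measure_ne_top _ _)).trans (measureReal_biUnion_finset_le Finset.univ A)
  simpa using h G hG

open Classical in
/-- The pairs of distinct vertices containing `v`. -/
noncomputable def star (v : V) : Finset (Sym2 V) :=
  (Finset.univ.erase v).image fun u => s(v, u)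

theorem card_star (v : V) : (star v).card = Fintype.card V - 1 := by
  classical
  rw [star, Finset.card_image_of_injective _ fun u u' h => Sym2.congr_right.1 h,
    Finset.card_erase_of_mem (Finset.mem_univ v), Finset.card_univ]

theorem not_isDiag_of_mem_star {v : V} {e : Sym2 V} (he : e ∈ star v) : ¬ e.IsDiag := by
  classical
  obtain ⟨u, hu, rfl⟩ := Finset.mem_image.1 he
  simpa using (Finset.ne_of_mem_erase hu).symm

theorem card_hits_star (G : SimpleGraph V) (v : V) : (hits G (star v)).card = (nb G v).card := by
  classical
  have : hits G (star v) = (nb G v).image fun u => s(v, u) := by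
    ext e
    simp only [mem_hits, star, Finset.mem_image, Finset.mem_erase, Finset.mem_univ, and_true, mem_nb]
    constructor
    · rintro ⟨⟨u, hu, rfl⟩, h⟩
      exact ⟨u, h, rfl⟩
    · rintro ⟨u, h, rfl⟩
      exact ⟨⟨u, h.ne', rfl⟩, h⟩
  rw [this, Finset.card_image_of_injective _ fun u u' h => Sym2.congr_right.1 h]

theorem exp_neg_one_le : Real.exp (-1) ≤ 0.37 := by
  have := Real.exp_neg_one_lt_d9
  linarith

theorem prob_low_degree_le (p : unitInterval) {d : ℝ} (hd : d = Fintype.card V * p)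
    (hn : 10 ≤ Fintype.card V) :
    (binomialRandom V p).real {G | ∃ v, ((nb G v).card : ℝ) < d / 4} ≤
      Fintype.card V * Real.exp (-(d / 4)) := by
  refine (binomialRandom_real_iUnion_le p
    (fun v : V => {G | (-1) * (d / 4) ≤ (-1) * ((hits G (star v)).card : ℝ)}) ?_).trans ?_
  · rintro G ⟨v, hv⟩
    refine ⟨v, ?_⟩
    rw [Set.mem_ofPred_eq, card_hits_star]
    linarith
  · rw [← nsmul_eq_mul, ← Finset.card_univ]
    refine Finset.sum_le_card_nsmul _ _ _ fun v _ => ?_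
    refine (binomialRandom_tail_le p _ (fun e he => not_isDiag_of_mem_star he) _ _).trans ?_
    rw [Real.exp_le_exp, card_star, Nat.cast_sub (by omega), Nat.cast_one]
    have h1 := exp_neg_one_le
    have hn' : (10 : ℝ) ≤ Fintype.card V := by exact_mod_cast hn
    have hp := p.2.1
    have h2 : 0.9 * d ≤ (Fintype.card V - 1) * p := by
      rw [hd]; nlinarith
    have h3 : 0 ≤ d := by rw [hd]; positivity
    nlinarith

theorem prob_high_degree_le (p : unitInterval) {d : ℝ} (hd : d = Fintype.card V * p) :
    (binomialRandom V p).real {G | ∃ v, 4 * d < ((nb G v).card : ℝ)} ≤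
      Fintype.card V * Real.exp (-(d / 4)) := by
  refine (binomialRandom_real_iUnion_le p
    (fun v : V => {G | 1 * (4 * d) ≤ 1 * ((hits G (star v)).card : ℝ)}) ?_).trans ?_
  · rintro G ⟨v, hv⟩
    refine ⟨v, ?_⟩
    rw [Set.mem_ofPred_eq, card_hits_star]
    linarith
  · rw [← nsmul_eq_mul, ← Finset.card_univ]
    refine Finset.sum_le_card_nsmul _ _ _ fun v _ => ?_
    refine (binomialRandom_tail_le p _ (fun e he => not_isDiag_of_mem_star he) _ _).trans ?_
    rw [Real.exp_le_exp, card_star]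
    have h1 := Real.exp_one_lt_d9
    have hp := p.2.1
    have h2 : ((Fintype.card V - 1 : ℕ) : ℝ) * p ≤ d := by
      rw [hd]
      refine mul_le_mul_of_nonneg_right ?_ hp
      exact_mod_cast Nat.sub_le _ _
    have h3 : 0 ≤ d := by rw [hd]; positivity
    have h4 : (0 : ℝ) ≤ ((Fintype.card V - 1 : ℕ) : ℝ) * p := by positivity
    nlinarith [Real.add_one_le_exp 1]

/-- Chernoff with exp l = 1/x, where x = √(|T|/n). Then |T|²p/2 · exp l = dx|T|/2 is at most half
the threshold m, so the exponent is at most (1/2 - l)m ≤ (4 - 8l)|T|, and exp(4 - 8l) ≤ 81x^8. -/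
theorem prob_dense_set_le (p : unitInterval) {d : ℝ} (hd : d = Fintype.card V * p) (T : Finset V)
    (h1 : 1 ≤ T.card) (h2 : (10 ^ 5 * T.card : ℝ) ≤ Fintype.card V) :
    (binomialRandom V p).real
      {G | max 8 (d * Real.sqrt (T.card / Fintype.card V)) * T.card <
        ((hits G (pairsIn T)).card : ℝ)} ≤
      (81 * ((T.card : ℝ) / Fintype.card V) ^ 4) ^ T.card := by
  set t : ℝ := (T.card : ℝ) with ht
  set n : ℝ := (Fintype.card V : ℝ) with hn
  have ht1 : 1 ≤ t := by rw [ht]; exact_mod_cast h1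
  have hn0 : 0 < n := by nlinarith
  set x : ℝ := Real.sqrt (t / n) with hx
  have hx0 : 0 < x := Real.sqrt_pos.2 (by positivity)
  have hx2 : x ^ 2 = t / n := Real.sq_sqrt (by positivity)
  set l : ℝ := -Real.log x with hl
  have hel : Real.exp l = x⁻¹ := by rw [hl, Real.exp_neg, Real.exp_log hx0]
  have hxs : x ≤ 1 / 100 := by
    rw [hx, Real.sqrt_le_left (by norm_num)]
    rw [div_le_iff₀ hn0]
    nlinarith
  have hl1 : 1 ≤ l := by
    rw [← Real.exp_le_exp, hel]
    have h3 : (100 : ℝ) ≤ x⁻¹ := by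
      rw [le_inv_comm₀ (by norm_num) hx0]; linarith
    linarith [Real.exp_one_lt_d9]
  set m : ℝ := max 8 (d * x) * t with hm
  have hm8 : 8 * t ≤ m := mul_le_mul_of_nonneg_right (le_max_left _ _) (by linarith)
  have hmd : d * x * t ≤ m := mul_le_mul_of_nonneg_right (le_max_right _ _) (by linarith)
  have hsub : {G : SimpleGraph V | m < ((hits G (pairsIn T)).card : ℝ)} ⊆
      {G | l * m ≤ l * ((hits G (pairsIn T)).card : ℝ)} := fun G hG =>
    mul_le_mul_of_nonneg_left (le_of_lt hG) (zero_le_one.trans hl1)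
  refine (measureReal_mono hsub).trans ((binomialRandom_tail_le p _ (fun e he => ?_) _ _).trans ?_)
  · simp only [pairsIn, Finset.mem_filter] at he
    exact he.2.1
  have hmean : ((pairsIn T).card : ℝ) * p * (Real.exp l - 1) ≤ m / 2 := by
    have hp := p.2.1
    have e1 := card_pairsIn_le T
    have e2 : t ^ 2 * p * x⁻¹ = d * x * t := by
      have e3 : t = x ^ 2 * n := by rw [hx2]; field_simp
      rw [hd]
      field_simp
      rw [e3]
      ring
    have e4 : 0 < x⁻¹ := by positivity
    calc ((pairsIn T).card : ℝ) * p * (Real.exp l - 1) ≤ (t ^ 2 / 2) * p * x⁻¹ := by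
          rw [hel]
          refine mul_le_mul (mul_le_mul_of_nonneg_right e1 hp) (by linarith) ?_ (by positivity)
          have : 1 ≤ x⁻¹ := by rw [le_inv_comm₀ one_pos hx0]; linarith
          linarith
      _ = d * x * t / 2 := by rw [← e2]; ring
      _ ≤ m / 2 := by linarith
  calc Real.exp ((pairsIn T).card * p * (Real.exp l - 1) - l * m)
      ≤ Real.exp (T.card * (4 - 8 * l)) := by
        rw [Real.exp_le_exp]
        have : (l - 1 / 2) * (8 * t) ≤ (l - 1 / 2) * m :=
          mul_le_mul_of_nonneg_left hm8 (by linarith)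
        rw [← ht]
        nlinarith
    _ = (Real.exp (4 - 8 * l)) ^ T.card := Real.exp_nat_mul _ _
    _ ≤ _ := by
      refine pow_le_pow_left₀ (Real.exp_pos _).le ?_ _
      have e1 : Real.exp (4 - 8 * l) = Real.exp 1 ^ 4 * x ^ 8 := by
        rw [hl, ← Real.exp_nat_mul, ← Real.exp_log (pow_pos hx0 8), Real.log_pow,
          ← Real.exp_add]
        congr 1
        push_cast
        ring
      have e2 : Real.exp 1 ^ 4 ≤ 81 := by
        have := pow_le_pow_left₀ (Real.exp_pos 1).le
          (by linarith [Real.exp_one_lt_d9] : Real.exp 1 ≤ 3) 4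
        norm_num at this ⊢
        exact this
      rw [e1, ← hx2]
      have e3 : (x ^ 2) ^ 4 = x ^ 8 := by ring
      rw [e3]
      exact mul_le_mul_of_nonneg_right e2 (by positivity)

theorem prob_not_locallySparse_le (p : unitInterval) {d : ℝ} (hd : d = Fintype.card V * p) :
    (binomialRandom V p).real {G | ¬ LocallySparse G d} ≤ 1 / Fintype.card V := by
  classical
  let c : ℕ → ℝ := fun t => (81 * ((t : ℝ) / Fintype.card V) ^ 4) ^ t
  refine (binomialRandom_real_iUnion_le p (fun T : Finset V =>
    if 1 ≤ T.card ∧ (10 ^ 5 * T.card : ℝ) ≤ Fintype.card V then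
      {G | max 8 (d * Real.sqrt (T.card / Fintype.card V)) * T.card <
        ((hits G (pairsIn T)).card : ℝ)} else ∅) ?_).trans ?_
  · intro G hG
    simp only [Set.mem_ofPred_eq, LocallySparse, not_forall, not_le] at hG
    obtain ⟨T, h1, h2, h3⟩ := hG
    refine ⟨T, ?_⟩
    rw [if_pos ⟨h1, h2⟩]
    exact h3
  · have hstep : ∀ T : Finset V, (binomialRandom V p).real
        (if 1 ≤ T.card ∧ (10 ^ 5 * T.card : ℝ) ≤ Fintype.card V then
          {G | max 8 (d * Real.sqrt (T.card / Fintype.card V)) * T.card <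
            ((hits G (pairsIn T)).card : ℝ)} else ∅) ≤
        if 1 ≤ T.card ∧ (10 ^ 5 * T.card : ℝ) ≤ Fintype.card V then c T.card else 0 := by
      intro T
      split_ifs with h
      · exact prob_dense_set_le p hd T h.1 h.2
      · simp
    refine (Finset.sum_le_sum fun T _ => hstep T).trans ?_
    refine (sum_small_sets_le c (B := 1 / Fintype.card V) (q := 1 / 8) (by norm_num) le_rfl
      (by positivity) ?_ (fun t => by positivity)).trans ?_
    · intro t ht htn
      have ht' : (0 : ℝ) < t := by exact_mod_cast ht
      have hn : (0 : ℝ) < Fintype.card V := by nlinarith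
      have htn' : 2 * t ≤ Fintype.card V := by
        have : (2 * t : ℝ) ≤ Fintype.card V := by linarith
        exact_mod_cast this
      have hτ : (t : ℝ) / Fintype.card V ≤ 1 / 10 ^ 5 := by
        rw [div_le_div_iff₀ hn (by norm_num)]; linarith
      -- With τ = t/n the base is (3/τ)·81τ^4 = τ·243τ²: the powers of τ give 1/n, those of 243τ²
      -- the geometric decay.
      have e1 : (3 * Fintype.card V / t : ℝ) ^ t * c t =
          ((t : ℝ) / Fintype.card V) ^ t * (243 * ((t : ℝ) / Fintype.card V) ^ 2) ^ t := by
        simp only [c]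
        rw [← mul_pow, ← mul_pow]
        congr 1
        field_simp
        ring
      rw [e1]
      refine mul_le_mul (div_pow_self_le ht htn') ?_ (by positivity) (by positivity)
      refine pow_le_pow_left₀ (by positivity) ?_ _
      calc 243 * ((t : ℝ) / Fintype.card V) ^ 2 ≤ 243 * (1 / 10 ^ 5) ^ 2 := by gcongr
        _ ≤ 1 / 8 := by norm_num
    · have : (0 : ℝ) ≤ 1 / Fintype.card V := by positivity
      linarith

theorem card_sparse_graphs_le [DecidableEq V] (M : ℕ) :
    {Γ : SimpleGraph V | Γ.edgeSet.ncard ≤ M}.ncard ≤ (Fintype.card (Sym2 V) + 1) ^ M := by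
  classical
  refine le_trans ?_ (card_small_finsets_le (α := Sym2 V) M)
  rw [← Set.ncard_coe_finset]
  refine Set.ncard_le_ncard_of_injOn (fun Γ => Finset.univ.filter (· ∈ Γ.edgeSet)) ?_ ?_
    (Set.toFinite _)
  · intro Γ hΓ
    rw [Finset.coe_filter]
    refine ⟨Finset.mem_univ _, ?_⟩
    rw [← Set.ncard_coe_finset, Finset.coe_filter]
    simpa using hΓ
  · intro Γ _ Γ' _ h
    rw [← edgeSet_inj]
    ext e
    have := congrArg (e ∈ ·) h
    simpa using this

-- For fixed Γ the set of boosters is fixed, so Chernoff bounds by exp(-m/4) the probability of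
-- seeing fewer than m, half the least possible mean. There are at most (n²)^(57n) = exp(114 n log
-- n) graphs Γ, and m/4 ≥ 625 n log n.
open PathList in
theorem prob_not_boosterRich_le (p : unitInterval) {d : ℝ} (hd : d = Fintype.card V * p)
    (hn : 10 ≤ Fintype.card V) (hlog : 10 ^ 16 * Real.log (Fintype.card V) ≤ d) :
    (binomialRandom V p).real {G | ¬ BoosterRich G d} ≤ 1 / Fintype.card V := by
  classical
  set n : ℝ := (Fintype.card V : ℝ) with hnR
  have hn10 : (10 : ℝ) ≤ n := by rw [hnR]; exact_mod_cast hn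
  have hlog0 : 0 ≤ Real.log n := Real.log_nonneg (by linarith)
  set m : ℝ := d * n / (4 * 10 ^ 12) with hm
  let 𝓢 : Finset (SimpleGraph V) := Finset.univ.filter fun Γ =>
    Γ.edgeSet.ncard ≤ 57 * Fintype.card V ∧ n ^ 2 / (2 * 10 ^ 12) ≤ (boosters Γ).card
  have h𝓢 : (𝓢.card : ℝ) ≤ Real.exp (114 * n * Real.log n) := by
    have h1 : 𝓢.card ≤ (Fintype.card (Sym2 V) + 1) ^ (57 * Fintype.card V) := by
      refine le_trans ?_ (card_sparse_graphs_le (V := V) (57 * Fintype.card V))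
      rw [← Set.ncard_coe_finset]
      refine Set.ncard_le_ncard ?_ (Set.toFinite _)
      intro Γ hΓ
      exact (Finset.mem_filter.1 hΓ).2.1
    have h2 : (Fintype.card (Sym2 V) + 1 : ℝ) ≤ n ^ 2 := by
      rw [Sym2.card, Nat.cast_choose_two]
      push_cast
      rw [← hnR]
      nlinarith
    calc (𝓢.card : ℝ) ≤ (Fintype.card (Sym2 V) + 1 : ℝ) ^ (57 * Fintype.card V) := by
          exact_mod_cast h1
      _ ≤ (n ^ 2) ^ (57 * Fintype.card V) := pow_le_pow_left₀ (by positivity) h2 _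
      _ = _ := by
        rw [← pow_mul, ← Real.exp_log (pow_pos (by linarith : 0 < n) _), Real.log_pow]
        congr 1
        push_cast
        rw [← hnR]
        ring
  refine (binomialRandom_real_iUnion_le p (fun Γ : 𝓢 =>
    {G | (-1) * m ≤ (-1) * ((hits G (boosters Γ.1)).card : ℝ)}) ?_).trans ?_
  · intro G hG
    simp only [Set.mem_ofPred_eq, BoosterRich, not_forall, not_le] at hG
    obtain ⟨Γ, h1, h2, h3⟩ := hG
    refine ⟨⟨Γ, by simp only [𝓢, Finset.mem_filter, Finset.mem_univ, true_and]; exact ⟨h1, h2⟩⟩, ?_⟩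
    rw [Set.mem_ofPred_eq]
    linarith
  · have hstep : ∀ Γ : 𝓢, (binomialRandom V p).real
        {G | (-1) * m ≤ (-1) * ((hits G (boosters Γ.1)).card : ℝ)} ≤ Real.exp (-(m / 4)) := by
      rintro ⟨Γ, hΓ⟩
      simp only [𝓢, Finset.mem_filter, Finset.mem_univ, true_and] at hΓ
      refine (binomialRandom_tail_le p _ (fun e he => ?_) _ _).trans ?_
      · simp only [boosters, Finset.mem_filter] at he
        exact he.2.1
      rw [Real.exp_le_exp]
      have h1 := exp_neg_one_le
      have h2 : 2 * m ≤ (boosters Γ).card * p := by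
        have : 2 * m = n ^ 2 / (2 * 10 ^ 12) * p := by rw [hm, hd]; ring
        rw [this]
        exact mul_le_mul_of_nonneg_right hΓ.2 p.2.1
      have h3 : 0 ≤ m := by
        have := p.2.1
        rw [hm, hd]; positivity
      nlinarith
    refine (Finset.sum_le_sum fun Γ _ => hstep Γ).trans ?_
    rw [Finset.sum_const, nsmul_eq_mul, Finset.card_univ, Fintype.card_coe]
    calc (𝓢.card : ℝ) * Real.exp (-(m / 4))
        ≤ Real.exp (114 * n * Real.log n) * Real.exp (-(m / 4)) :=
          mul_le_mul_of_nonneg_right h𝓢 (Real.exp_pos _).le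
      _ = Real.exp (114 * n * Real.log n - m / 4) := by rw [← Real.exp_add]; ring_nf
      _ ≤ Real.exp (-Real.log n) := by
        rw [Real.exp_le_exp]
        have h1 : 10 ^ 16 * Real.log n * n ≤ d * n := by
          exact mul_le_mul_of_nonneg_right hlog (by linarith)
        have h2 : m / 4 = d * n / (16 * 10 ^ 12) := by rw [hm]; ring
        have h3 : 625 * (Real.log n * n) ≤ m / 4 := by
          rw [h2, le_div_iff₀ (by norm_num)]
          linarith
        nlinarith
      _ = 1 / n := by rw [Real.exp_neg, Real.exp_log (by linarith), one_div]

end SparseExpander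

/-! ### Assembling the probability estimate -/

namespace SparseExpander

open MeasureTheory SimpleGraph

/-- Four bad events (a low degree, a high degree, a dense small set, a sparse graph with too few
boosters in G) each have probability at most 1/n; outside them the deterministic core treats all
systems at once. -/
theorem le_binomialRandom_real (n : ℕ) (hn : 10 ^ 6 ≤ n) (p : unitInterval)
    (hlog : 10 ^ 16 * Real.log n ≤ n * p) :
    1 - 4 / (n : ℝ) ≤ (binomialRandom (Fin n) p).real
      {G : SimpleGraph (Fin n) | ∀ F : IncompatibilitySystem G,
        F.IsBounded (1 / 10 ^ 15 * (n : ℝ) * (p : ℝ)) → F.HasCompatibleHamiltonCycle} := by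
  set d : ℝ := n * p with hd
  set A := {G : SimpleGraph (Fin n) | ∀ F : IncompatibilitySystem G,
    F.IsBounded (1 / 10 ^ 15 * (n : ℝ) * (p : ℝ)) → F.HasCompatibleHamiltonCycle} with hA
  have hnR : (10 ^ 6 : ℝ) ≤ n := by exact_mod_cast hn
  have hn0 : (0 : ℝ) < n := by linarith
  have hlog1 : 1 ≤ Real.log n := by
    rw [Real.le_log_iff_exp_le hn0]
    linarith [Real.exp_one_lt_d9]
  have hd4 : 10 ^ 4 ≤ d := by linarith
  have hcard : ((Fintype.card (Fin n) : ℕ) : ℝ) = n := by rw [Fintype.card_fin]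
  have hd' : d = (Fintype.card (Fin n) : ℝ) * p := by rw [hcard]
  have hexp : ∀ c : ℝ, 2 * Real.log n ≤ c → n * Real.exp (-c) ≤ 1 / n := by
    intro c hc
    calc n * Real.exp (-c) ≤ n * Real.exp (-(2 * Real.log n)) := by gcongr
      _ = 1 / n := by
        rw [neg_mul_eq_mul_neg, mul_comm 2, Real.exp_mul, Real.exp_neg, Real.exp_log hn0]
        norm_num
        field_simp
  have hsub : Aᶜ ⊆ (({G | ∃ v, ((nb G v).card : ℝ) < d / 4} ∪
      {G | ∃ v, 4 * d < ((nb G v).card : ℝ)}) ∪ {G | ¬ LocallySparse G d}) ∪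
      {G | ¬ BoosterRich G d} := by
    intro G hG
    by_contra hcon
    simp only [Set.mem_union, Set.mem_ofPred_eq, not_or, not_exists, not_lt, not_not] at hcon
    obtain ⟨⟨⟨h1, h2⟩, h3⟩, h4⟩ := hcon
    refine hG fun F hF => ?_
    refine hasCompatibleHamiltonCycle hd4 (by rwa [Fintype.card_fin]) hF ?_ ?_ h1 h2 ?_ h3 h4
    · have := p.2.1
      positivity
    · rw [hd]
      apply le_of_eq
      ring
    · have h5 := hexp (d / 100) (by linarith)
      have h6 : 1 / (n : ℝ) ≤ 1 / 10 ^ 6 := one_div_le_one_div_of_le (by norm_num) hnR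
      rw [hcard]
      linarith
  have hcompl : (binomialRandom (Fin n) p).real Aᶜ ≤ 4 / n := by
    have e1 := prob_low_degree_le p hd' (by rw [Fintype.card_fin]; omega)
    have e2 := prob_high_degree_le p hd'
    have e3 := prob_not_locallySparse_le p hd'
    have e4 := prob_not_boosterRich_le p hd' (by rw [Fintype.card_fin]; omega) (by rwa [hcard])
    rw [hcard] at e1 e2 e3 e4
    have e5 := hexp (d / 4) (by linarith)
    calc _ ≤ _ := measureReal_mono hsub (measure_ne_top _ _)
      _ ≤ _ := measureReal_union_le _ _
      _ ≤ _ := add_le_add_left (measureReal_union_le _ _) _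
      _ ≤ _ := add_le_add_left (add_le_add_left (measureReal_union_le _ _) _) _
      _ ≤ 1 / n + 1 / n + 1 / n + 1 / n := by linarith
      _ = 4 / n := by ring
  have htot : 1 ≤ (binomialRandom (Fin n) p).real A + (binomialRandom (Fin n) p).real Aᶜ := by
    have := measureReal_union_le (μ := binomialRandom (Fin n) p) A Aᶜ
    rwa [Set.union_compl_self, probReal_univ] at this
  linarith

end SparseExpander

theorem theorem1 :
    ∃ μ : ℝ, 0 < μ ∧
      ∀ p : ℕ → unitInterval,
        Asymptotics.IsLittleO Filter.atTop
          (fun n : ℕ => Real.log (n : ℝ) / (n : ℝ)) (fun n : ℕ => (p n : ℝ)) →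
        Filter.Tendsto
          (fun n : ℕ => SimpleGraph.binomialRandom (Fin n) (p n)
            {G : SimpleGraph (Fin n) | ∀ F : IncompatibilitySystem G,
              F.IsBounded (μ * (n : ℝ) * (p n : ℝ)) → F.HasCompatibleHamiltonCycle})
          Filter.atTop (nhds 1) := by
  refine ⟨1 / 10 ^ 15, by norm_num, fun p hp => ?_⟩
  have hlim : Filter.Tendsto (fun n : ℕ => ENNReal.ofReal (1 - 4 / (n : ℝ))) Filter.atTop
      (nhds 1) := by
    rw [← ENNReal.ofReal_one]
    refine (ENNReal.continuous_ofReal.tendsto _).comp ?_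
    simpa using (tendsto_const_div_atTop_nhds_zero_nat (4 : ℝ)).const_sub 1
  refine tendsto_of_tendsto_of_tendsto_of_le_of_le' hlim tendsto_const_nhds ?_
    (Filter.Eventually.of_forall fun n => MeasureTheory.prob_le_one)
  -- The little-o hypothesis enters only through this one constant: eventually np ≥ 10^16 log n.
  filter_upwards [hp.bound (by norm_num : (0 : ℝ) < 1 / 10 ^ 16),
    Filter.eventually_ge_atTop (10 ^ 6)] with n hbound hn
  have hn0 : (0 : ℝ) < n := by exact_mod_cast (by omega : 0 < n)
  have hlog0 : 0 ≤ Real.log n := Real.log_nonneg (by exact_mod_cast (by omega : 1 ≤ n))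
  rw [Real.norm_of_nonneg (div_nonneg hlog0 hn0.le), Real.norm_of_nonneg (p n).2.1,
    div_le_iff₀ hn0] at hbound
  have := SparseExpander.le_binomialRandom_real n hn (p n) (by linarith)
  rw [ENNReal.ofReal_le_iff_le_toReal (MeasureTheory.measure_ne_top _ _)]
  exact this
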